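/- **Setting.** Let $M$ be a closed connected topological $3$-manifold and $T$ a finite triangulation of $M$ (an abstract simplicial complex with a homeomorphism from its geometric realization to $M$), with vertex set $V$. A (piecewise flat) metric on $(M,T)$ is a real function $d$ on the directed edges, $(i,j)\mapsto d_{ij}$, such that, with $\ell_{ij}=d_{ij}+d_{ji}$, every simplex of $T$ embeds in Euclidean space as a nondegenerate simplex with edge lengths $\ell$, and $d_{ij}^2+d_{jk}^2+d_{ki}^2=d_{ji}^2+d_{ik}^2+d_{kj}^2$ for every triangle $\{i,j,k\}$. Let $\gamma_{i,jk}$ be the Euclidean angle at $i$ in the triangle $\{i,j,k\}$ and $\beta_{ij,kl}$ the dihedral angle at the edge $\{i,j\}$ in the tetrahedron $\{i,j,k,l\}$, and put $$h_{ij,k}=\frac{d_{ik}-d_{ij}\cos\gamma_{i,jk}}{\sin\gamma_{i,jk}},\qquad h_{ijk,l}=\frac{h_{ij,l}-h_{ij,k}\cos\beta_{ij,kl}}{\sin\beta_{ij,kl}},$$ $$\ell^*_{ij}=\sum_{k,l}\tfrac12\left(h_{ij,k}h_{ijk,l}+h_{ij,l}h_{ijl,k}\right),\qquad K_{ij}=\Big(2\pi-\sum_{k,l}\beta_{ij,kl}\Big)\ell_{ij},\qquad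 K_i=\sum_{j}\Big(2\pi-\sum_{k,l}\beta_{ij,kl}\Big)d_{ij},$$ where the sums over $k,l$ run over all tetrahedra $\{i,j,k,l\}$ containing the edge $\{i,j\}$ (each counted once), and the sum over $j$ over all edges $\{i,j\}$ at $i$. The metric $d$ is *Ricci flat* if $K_{ij}=0$ for all edges; $(K_i)_{i\in V}$ is its *scalar curvature*. A *conformal structure* is a smooth map $\mathcal C$ from an open set $U\subset\mathbb R^V$ to the space of metrics on $(M,T)$ such that, writing $d=\mathcal C[f]$, $\partial \ell_{ij}/\partial f_i=d_{ij}$ and $\partial d_{ij}/\partial f_k=0$ for $k\ne i,j$, for every directed edge $(i,j)$. A *conformal variation* of a metric $\bar d$ is a smooth curve $f:(-\varepsilon,\varepsilon)\to\mathbb R^V$, $\varepsilon>0$, for which there is a conformal structure $\mathcal C$ with $f(-\varepsilon,\varepsilon)\subset U$ and $\mathcal C[f(0)]=\bar d$. The metric $\bar d$ is *rigid* with respect to conformal variations if for every conformal variation $f$ of $\bar d$ and every such $\mathcal C$: if the scalar curvature of $d(t)=\mathcal C[f(t)]$ is fixed, i.e. $K_i(d(t))=K_i(\bar d)$ for all $i\in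 V$ and $|t|<\varepsilon$, then $d(t)$ is a uniform scaling of $\bar d$: for every $|t|<\varepsilon$ there is $c>0$ with $d_{ij}(t)=c\,\bar d_{ij}$ for all directed edges $(i,j)$ (so all edge lengths are multiplied by $c$). **Theorem.** Let $d$ be a Ricci flat metric on $(M,T)$. Suppose that either 1. $\ell^*_{ij}>0$ for every edge $\{i,j\}$ of $T$, or 2. $d$ lies in the sphere packing conformal structure, i.e. there is $f\in\mathbb R^V$ with $d_{ij}=e^{f_i}$ for every directed edge $(i,j)$. Then $d$ is rigid with respect to conformal variations. (For Ricci flat $d$ one has $K_i(d)=0$ for all $i$, so the variations in question are those through metrics of zero scalar curvature; in particular this covers every variation through Ricci flat metrics.) -/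

import Mathlib

open Set
open scoped ContDiff

noncomputable section

namespace PiecewiseFlat

variable {V : Type*} [Fintype V] [DecidableEq V]

/-! ### Triangulations -/

/-- The geometric realization of a finite abstract simplicial complex, in barycentric
coordinates, as a subspace of `V → ℝ`. -/
def realization (K : AbstractSimplicialComplex V) : Set (V → ℝ) :=
  {x | (∀ i, 0 ≤ x i) ∧ ∑ i, x i = 1 ∧ ∃ s ∈ K.faces, ∀ i, i ∉ s → x i = 0}

/-- `K` is a triangulation of the topological space `M`. -/
def IsTriangulation (K : AbstractSimplicialComplex V) (M : Type*) [TopologicalSpace M] : Prop :=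
  Nonempty (realization K ≃ₜ M)

/-- `(i, j)` is a directed edge. -/
def IsEdge (K : AbstractSimplicialComplex V) (i j : V) : Prop :=
  i ≠ j ∧ ({i, j} : Finset V) ∈ K.faces

/-- `i, j, k` are the distinct vertices of a triangle. -/
def IsTriangle (K : AbstractSimplicialComplex V) (i j k : V) : Prop :=
  ({i, j, k} : Finset V).card = 3 ∧ ({i, j, k} : Finset V) ∈ K.faces

/-- `i, j, k, l` are the distinct vertices of a tetrahedron. -/
def IsTetrahedron (K : AbstractSimplicialComplex V) (i j k l : V) : Prop :=
  ({i, j, k, l} : Finset V).card = 4 ∧ ({i, j, k, l} : Finset V) ∈ K.faces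

/-! ### Piecewise flat metrics

A function on the directed edges is represented by a function `d : V → V → ℝ`; only its values
`d i j` at directed edges `(i, j)` are ever used. -/

/-- The edge length `ℓ_ij = d_ij + d_ji`. -/
def len (d : V → V → ℝ) (i j : V) : ℝ := d i j + d j i

/-- Every simplex embeds in Euclidean 3-space as a nondegenerate simplex with the edge lengths
determined by `d`. -/
def IsPreMetric (K : AbstractSimplicialComplex V) (d : V → V → ℝ) : Prop :=
  ∀ s ∈ K.faces, ∃ p : V → EuclideanSpace ℝ (Fin 3),
    AffineIndependent ℝ (fun i : s => p i) ∧
      ∀ i ∈ s, ∀ j ∈ s, i ≠ j → dist (p i) (p j) = len d i j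

/-- The space of piecewise flat metrics on a 3-dimensional triangulated manifold. -/
def met (K : AbstractSimplicialComplex V) : Set (V → V → ℝ) :=
  {d | IsPreMetric K d ∧ ∀ i j k, IsTriangle K i j k →
    d i j ^ 2 + d j k ^ 2 + d k i ^ 2 = d j i ^ 2 + d i k ^ 2 + d k j ^ 2}

/-! ### Angles, dual lengths, curvatures -/

/-- The angle `γ_{i,jk}` at `i` in the triangle `{i, j, k}` (law of cosines). -/
def faceAngle (d : V → V → ℝ) (i j k : V) : ℝ :=
  Real.arccos ((len d i j ^ 2 + len d i k ^ 2 - len d j k ^ 2) / (2 * len d i j * len d i k))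

/-- The dihedral angle `β_{ij,kl}` at the edge `{i, j}` in the tetrahedron `{i, j, k, l}`
(spherical law of cosines at the vertex `i`). -/
def dihedralAngle (d : V → V → ℝ) (i j k l : V) : ℝ :=
  Real.arccos
    ((Real.cos (faceAngle d i k l) - Real.cos (faceAngle d i j k) * Real.cos (faceAngle d i j l)) /
      (Real.sin (faceAngle d i j k) * Real.sin (faceAngle d i j l)))

/-- `h_{ij,k}`, the signed distance from the center of the triangle `{i, j, k}` to the center of
the edge `{i, j}`. -/
def triHeight (d : V → V → ℝ) (i j k : V) : ℝ :=
  (d i k - d i j * Real.cos (faceAngle d i j k)) / Real.sin (faceAngle d i j k)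

/-- `h_{ijk,l}`, the signed distance from the center of the tetrahedron `{i, j, k, l}` to the
center of the triangle `{i, j, k}`. -/
def tetHeight (d : V → V → ℝ) (i j k l : V) : ℝ :=
  (triHeight d i j l - triHeight d i j k * Real.cos (dihedralAngle d i j k l)) /
    Real.sin (dihedralAngle d i j k l)

/-- `A_{ij,kl}`, the signed dual area of the edge `{i, j}` in the tetrahedron `{i, j, k, l}`. -/
def dualArea (d : V → V → ℝ) (i j k l : V) : ℝ :=
  (triHeight d i j k * tetHeight d i j k l + triHeight d i j l * tetHeight d i j l k) / 2

open scoped Classical in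
/-- The sum of `F k l` over the tetrahedra `{i, j, k, l}` containing the edge `{i, j}`, for `F`
symmetric in `k, l`. Summing over ordered pairs `(k, l)` counts every tetrahedron twice, whence
the factor `1 / 2`. -/
def sumTetrahedra (K : AbstractSimplicialComplex V) (i j : V) (F : V → V → ℝ) : ℝ :=
  (1 / 2) * ∑ k, ∑ l, if IsTetrahedron K i j k l then F k l else 0

/-- The dual length `ℓ*_ij` of an edge (an area). -/
def dualLength (K : AbstractSimplicialComplex V) (d : V → V → ℝ) (i j : V) : ℝ :=
  sumTetrahedra K i j (fun k l => dualArea d i j k l)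

/-- The angle deficit `2π - ∑ β_{ij,kl}` at the edge `{i, j}`. -/
def deficit (K : AbstractSimplicialComplex V) (d : V → V → ℝ) (i j : V) : ℝ :=
  2 * Real.pi - sumTetrahedra K i j (fun k l => dihedralAngle d i j k l)

/-- The edge curvature `K_ij`. -/
def edgeCurvature (K : AbstractSimplicialComplex V) (d : V → V → ℝ) (i j : V) : ℝ :=
  deficit K d i j * len d i j

open scoped Classical in
/-- The scalar curvature `K_i`, a function on the vertices. -/
def scalarCurvature (K : AbstractSimplicialComplex V) (d : V → V → ℝ) (i : V) : ℝ :=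
  ∑ j, if IsEdge K i j then deficit K d i j * d i j else 0

/-- Ricci flat: all edge curvatures vanish. -/
def IsRicciFlat (K : AbstractSimplicialComplex V) (d : V → V → ℝ) : Prop :=
  ∀ i j, IsEdge K i j → edgeCurvature K d i j = 0

/-! ### Conformal structures and rigidity -/

/-- A conformal structure `𝒞(M, T, U)`: a smooth map from an open set `U` of functions on the
vertices to the space of metrics, with `∂ℓ_ij/∂f_i = d_ij`, and `∂d_ij/∂f_k = 0` for `k ≠ i, j`.
Partial derivatives are derivatives along the vectors of the standard basis of `V → ℝ`. -/
structure ConformalStructure (K : AbstractSimplicialComplex V) where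
  U : Set (V → ℝ)
  isOpen_U : IsOpen U
  metric : (V → ℝ) → V → V → ℝ
  metric_mem : ∀ f ∈ U, metric f ∈ met K
  smooth : ∀ i j, IsEdge K i j → ContDiffOn ℝ ∞ (fun f => metric f i j) U
  partial_len : ∀ f ∈ U, ∀ i j, IsEdge K i j →
    HasLineDerivAt ℝ (fun g => len (metric g) i j) (metric f i j) f (Pi.single i 1)
  partial_metric : ∀ f ∈ U, ∀ i j, IsEdge K i j → ∀ k, k ≠ i → k ≠ j →
    HasLineDerivAt ℝ (fun g => metric g i j) 0 f (Pi.single k 1)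

/-- The smooth curve `f : (-ε, ε) → V(T)*` is a conformal variation of the metric `d`, with
extension `C`. -/
def IsConformalVariation (K : AbstractSimplicialComplex V) (d : V → V → ℝ) (ε : ℝ)
    (f : ℝ → V → ℝ) (C : ConformalStructure K) : Prop :=
  ContDiffOn ℝ ∞ f (Ioo (-ε) ε) ∧ (∀ t ∈ Ioo (-ε) ε, f t ∈ C.U) ∧
    ∀ i j, IsEdge K i j → C.metric (f 0) i j = d i j

/-- `d` is rigid with respect to conformal variations: a conformal variation under which the
(scalar) curvature remains fixed can only scale `d`, hence the edge lengths, uniformly. -/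
def IsRigid (K : AbstractSimplicialComplex V) (d : V → V → ℝ) : Prop :=
  ∀ (ε : ℝ) (f : ℝ → V → ℝ) (C : ConformalStructure K), 0 < ε →
    IsConformalVariation K d ε f C →
    (∀ t ∈ Ioo (-ε) ε, ∀ i, scalarCurvature K (C.metric (f t)) i = scalarCurvature K d i) →
    ∀ t ∈ Ioo (-ε) ε, ∃ c : ℝ, 0 < c ∧ ∀ i j, IsEdge K i j → C.metric (f t) i j = c * d i j

/-- `d` belongs to the sphere packing conformal structure: `d_ij = exp f_i` for a function `f` on
the vertices. -/
def IsSpherePacking (K : AbstractSimplicialComplex V) (d : V → V → ℝ) : Prop :=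
  ∃ f : V → ℝ, ∀ i j, IsEdge K i j → d i j = Real.exp (f i)

end PiecewiseFlat

end

/-! At a Ricci flat metric every angle deficit vanishes, so in the derivative of `K_i` only the
variation of the dihedral angles survives. In a tetrahedron, the derivatives of the three dihedral
angles at the vertex `i`, weighted by `d_ij`, combine into dual areas
(`IsConformalCurve.hasDerivAt_dihedralAngle`). Hence the linearized scalar curvature is minus the
graph Laplacian with weights `2 ℓ*_ij / ℓ_ij` (`IsConformalCurve.hasDerivAt_scalarCurvature`).

The kernel of this Laplacian consists of the constants. If `ℓ* > 0`, this is the maximum principle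
on the connected `1`-skeleton. For a sphere packing metric some weights may be negative. There the
Dirichlet form is split into one quadratic form per tetrahedron, and each of these is positive
semidefinite with only constants in its kernel (`packForm_nonneg`), because a tetrahedron of tangent
spheres is nondegenerate.

Shifting `f` by a constant scales the metric. Since this is the whole kernel, the inverse function
theorem shows that near a Ricci flat metric of either kind the only metrics of zero scalar curvature
in a conformal structure are its scalings. Both hypotheses are invariant under scaling, so along a
variation the set of times at which the metric is a scaling of `d` is open. It is also closed and
contains `0`, hence it is the whole interval. -/

noncomputable section

namespace PiecewiseFlat

section Nondegeneracy

variable {V : Type*}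

/-! ### Combinatorics of simplices -/

section Combinatorics

theorem face_of_subset {K : AbstractSimplicialComplex V} {s t : Finset V}
    (hs : s ∈ K.faces) (hts : t ⊆ s) (ht : t.Nonempty) :
    t ∈ K.faces :=
  (K.isRelLowerSet_faces hs).2 hts ht

variable [DecidableEq V] {K : AbstractSimplicialComplex V} {i j k l : V}

theorem IsEdge.symm (h : IsEdge K i j) : IsEdge K j i :=
  ⟨h.1.symm, by rw [Finset.pair_comm]; exact h.2⟩

theorem isTriangle_iff : IsTriangle K i j k ↔
    (i ≠ j ∧ i ≠ k ∧ j ≠ k) ∧ ({i, j, k} : Finset V) ∈ K.faces := by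
  unfold IsTriangle
  refine and_congr_left fun _ =>
    ⟨fun h => ?_, fun ⟨h1, h2, h3⟩ => Finset.card_eq_three.2 ⟨i, j, k, h1, h2, h3, rfl⟩⟩
  have h2 : ∀ a b : V, ({a, b} : Finset V).card ≤ 2 := fun a b => Finset.card_le_two
  refine ⟨?_, ?_, ?_⟩ <;> intro e <;> subst e
  · have := h2 i k; simp only [Finset.insert_idem] at h; omega
  · have := h2 j i; rw [Finset.insert_comm] at h; simp only [Finset.pair_eq_singleton] at h; omega
  · have := h2 i j; simp only [Finset.pair_eq_singleton] at h; omega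

theorem isTetrahedron_iff : IsTetrahedron K i j k l ↔
    (i ≠ j ∧ i ≠ k ∧ i ≠ l ∧ j ≠ k ∧ j ≠ l ∧ k ≠ l) ∧ ({i, j, k, l} : Finset V) ∈ K.faces := by
  unfold IsTetrahedron
  refine and_congr_left fun _ => ⟨fun h => ?_, fun ⟨h1, h2, h3, h4, h5, h6⟩ => by
    rw [Finset.card_insert_of_notMem (by simp [*]),
      Finset.card_eq_three.2 ⟨j, k, l, h4, h5, h6, rfl⟩]⟩
  have h3 : ∀ a b c : V, ({a, b, c} : Finset V).card ≤ 3 := fun a b c => Finset.card_le_three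
  have key : ∀ a b c : V, ({i, j, k, l} : Finset V) ⊆ {a, b, c} → False := fun a b c hs => by
    have := Finset.card_le_card hs
    have := h3 a b c
    omega
  refine ⟨?_, ?_, ?_, ?_, ?_, ?_⟩ <;> intro e <;> subst e
  · exact key i k l (by intro x; simp)
  · exact key i j l (by intro x; simp; tauto)
  · exact key i j k (by intro x; simp; tauto)
  · exact key i j l (by intro x; simp)
  · exact key i j k (by intro x; simp; tauto)
  · exact key i j k (by intro x; simp)

theorem IsTriangle.swap₁₂ (h : IsTriangle K i j k) : IsTriangle K j i k := by
  unfold IsTriangle at *; rwa [Finset.insert_comm j i]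

theorem IsTriangle.swap₂₃ (h : IsTriangle K i j k) : IsTriangle K i k j := by
  unfold IsTriangle at *; rwa [Finset.pair_comm k j]

theorem IsTetrahedron.swap₁₂ (h : IsTetrahedron K i j k l) : IsTetrahedron K j i k l := by
  unfold IsTetrahedron at *; rwa [Finset.insert_comm j i]

theorem IsTetrahedron.swap₂₃ (h : IsTetrahedron K i j k l) : IsTetrahedron K i k j l := by
  unfold IsTetrahedron at *; rwa [Finset.insert_comm k j]

theorem IsTetrahedron.swap₃₄ (h : IsTetrahedron K i j k l) : IsTetrahedron K i j l k := by
  unfold IsTetrahedron at *; rwa [Finset.pair_comm l k]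

theorem IsTetrahedron.rotate (h : IsTetrahedron K i j k l) : IsTetrahedron K i k l j :=
  h.swap₂₃.swap₃₄

theorem IsTetrahedron.triangle (h : IsTetrahedron K i j k l) : IsTriangle K i j k := by
  rw [isTetrahedron_iff] at h
  refine isTriangle_iff.2 ⟨⟨h.1.1, h.1.2.1, h.1.2.2.2.1⟩, face_of_subset h.2 ?_ (by simp)⟩
  intro x; simp; tauto

theorem IsTriangle.edge (h : IsTriangle K i j k) : IsEdge K i j := by
  rw [isTriangle_iff] at h
  refine ⟨h.1.1, face_of_subset h.2 ?_ (by simp)⟩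
  intro x; simp; tauto

theorem IsTetrahedron.edge (h : IsTetrahedron K i j k l) : IsEdge K i j := h.triangle.edge

end Combinatorics

/-! ### Nondegeneracy -/

/-- The cosine of the face angle at `i`, as a rational function of the edge lengths. -/
def faceCos (d : V → V → ℝ) (i j k : V) : ℝ :=
  (len d i j ^ 2 + len d i k ^ 2 - len d j k ^ 2) / (2 * len d i j * len d i k)

theorem len_comm (d : V → V → ℝ) (i j : V) : len d i j = len d j i := add_comm _ _

theorem faceAngle_comm (d : V → V → ℝ) (i j k : V) : faceAngle d i j k = faceAngle d i k j := by
  unfold faceAngle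
  rw [len_comm d j k, add_comm (len d i j ^ 2), mul_right_comm]

section Nondegenerate

variable [DecidableEq V] {K : AbstractSimplicialComplex V} {d : V → V → ℝ} {i j k l : V}

theorem IsPreMetric.len_pos (hd : IsPreMetric K d) (h : IsEdge K i j) : 0 < len d i j := by
  obtain ⟨p, hp, hl⟩ := hd _ h.2
  rw [← hl i (by simp) j (by simp) h.1, dist_pos]
  intro hpp
  have := hp.injective (a₁ := (⟨i, by simp⟩ : ({i, j} : Finset V)))
    (a₂ := ⟨j, by simp⟩) hpp
  exact h.1 (by simpa using this)

theorem linearIndependent_sub_of_affineIndependent {n : ℕ}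
    {q : Fin (n + 1) → EuclideanSpace ℝ (Fin 3)} (hq : AffineIndependent ℝ q) :
    LinearIndependent ℝ (fun m : Fin n => q m.succ - q 0) := by
  rw [affineIndependent_iff_linearIndependent_vsub ℝ _ (0 : Fin (n + 1))] at hq
  exact hq.comp (fun m : Fin n => (⟨m.succ, Fin.succ_ne_zero m⟩ : {x : Fin (n + 1) // x ≠ 0}))
    (fun a b hab => by simpa using hab)

theorem IsPreMetric.exists_vectors_triangle (hd : IsPreMetric K d) (h : IsTriangle K i j k) :
    ∃ v : Fin 2 → EuclideanSpace ℝ (Fin 3), LinearIndependent ℝ v ∧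
      ‖v 0‖ = len d i j ∧ ‖v 1‖ = len d i k ∧ ‖v 0 - v 1‖ = len d j k := by
  rw [isTriangle_iff] at h
  obtain ⟨⟨hij, hik, hjk⟩, hf⟩ := h
  obtain ⟨p, hp, hl⟩ := hd _ hf
  let e : Fin 3 → ({i, j, k} : Finset V) := ![⟨i, by simp⟩, ⟨j, by simp⟩, ⟨k, by simp⟩]
  have he : Function.Injective e := by
    intro a b hab
    fin_cases a <;> fin_cases b <;> simp [e] at hab ⊢ <;> grind
  refine ⟨_, linearIndependent_sub_of_affineIndependent (hp.comp_embedding ⟨e, he⟩), ?_, ?_, ?_⟩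
  · rw [← hl i (by simp) j (by simp) hij, dist_comm, dist_eq_norm]; simp [e]
  · rw [← hl i (by simp) k (by simp) hik, dist_comm, dist_eq_norm]; simp [e]
  · rw [← hl j (by simp) k (by simp) hjk, dist_eq_norm]; simp [e]

theorem IsPreMetric.exists_vectors_tetrahedron (hd : IsPreMetric K d)
    (h : IsTetrahedron K i j k l) :
    ∃ v : Fin 3 → EuclideanSpace ℝ (Fin 3), LinearIndependent ℝ v ∧
      (‖v 0‖ = len d i j ∧ ‖v 1‖ = len d i k ∧ ‖v 2‖ = len d i l) ∧
      ‖v 0 - v 1‖ = len d j k ∧ ‖v 0 - v 2‖ = len d j l ∧ ‖v 1 - v 2‖ = len d k l := by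
  rw [isTetrahedron_iff] at h
  obtain ⟨⟨hij, hik, hil, hjk, hjl, hkl⟩, hf⟩ := h
  obtain ⟨p, hp, hl⟩ := hd _ hf
  let e : Fin 4 → ({i, j, k, l} : Finset V) :=
    ![⟨i, by simp⟩, ⟨j, by simp⟩, ⟨k, by simp⟩, ⟨l, by simp⟩]
  have he : Function.Injective e := by
    intro a b hab
    fin_cases a <;> fin_cases b <;> simp [e] at hab ⊢ <;> grind
  refine ⟨_, linearIndependent_sub_of_affineIndependent (hp.comp_embedding ⟨e, he⟩),
    ⟨?_, ?_, ?_⟩, ?_, ?_, ?_⟩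
  · rw [← hl i (by simp) j (by simp) hij, dist_comm, dist_eq_norm]; simp [e]
  · rw [← hl i (by simp) k (by simp) hik, dist_comm, dist_eq_norm]; simp [e]
  · rw [← hl i (by simp) l (by simp) hil, dist_comm, dist_eq_norm]; simp [e]
  · rw [← hl j (by simp) k (by simp) hjk, dist_eq_norm]; simp [e]
  · rw [← hl j (by simp) l (by simp) hjl, dist_eq_norm]; simp [e]
  · rw [← hl k (by simp) l (by simp) hkl, dist_eq_norm]; simp [e]

/-- The law of cosines for vectors, in the form used by `faceCos`. -/
theorem inner_eq_mul_cos (u v : EuclideanSpace ℝ (Fin 3)) (hu : 0 < ‖u‖) (hv : 0 < ‖v‖) :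
    inner ℝ u v = ‖u‖ * ‖v‖ * ((‖u‖ ^ 2 + ‖v‖ ^ 2 - ‖u - v‖ ^ 2) / (2 * ‖u‖ * ‖v‖)) := by
  rw [@norm_sub_sq_real]
  field_simp
  ring

/-- The Gram determinant of the two edge vectors at `i` is `ℓ_ij² ℓ_ik² (1 - cos²)`. The strict
bound keeps `arccos` where it inverts the cosine and is smooth. -/
theorem IsPreMetric.faceCos_sq_lt (hd : IsPreMetric K d) (h : IsTriangle K i j k) :
    faceCos d i j k ^ 2 < 1 := by
  obtain ⟨v, hv, h0, h1, h01⟩ := hd.exists_vectors_triangle h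
  have p0 : 0 < ‖v 0‖ := by rw [h0]; exact hd.len_pos h.edge
  have p1 : 0 < ‖v 1‖ := by rw [h1]; exact hd.len_pos h.swap₂₃.edge
  have hdet := (Matrix.posDef_gram_of_linearIndependent (𝕜 := ℝ) hv).det_pos
  rw [Matrix.det_fin_two] at hdet
  simp only [Matrix.gram_apply] at hdet
  rw [real_inner_comm (v 0) (v 1), inner_eq_mul_cos _ _ p0 p1, real_inner_self_eq_norm_sq,
    real_inner_self_eq_norm_sq, h0, h1, h01] at hdet
  change 0 < _ - _ * faceCos d i j k * (_ * faceCos d i j k) at hdet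
  rw [h0] at p0
  rw [h1] at p1
  have hp : 0 < (len d i j * len d i k) ^ 2 := by positivity
  by_contra hc
  nlinarith

/-- This is the Gram determinant of the three edge vectors at `i`, divided by the product of their
squared lengths. -/
theorem IsPreMetric.gram_pos (hd : IsPreMetric K d) (h : IsTetrahedron K i j k l) :
    0 < 1 - faceCos d i j k ^ 2 - faceCos d i j l ^ 2 - faceCos d i k l ^ 2 +
      2 * faceCos d i j k * faceCos d i j l * faceCos d i k l := by
  obtain ⟨v, hv, ⟨h0, h1, h2⟩, h01, h02, h12⟩ := hd.exists_vectors_tetrahedron h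
  have p0 : 0 < ‖v 0‖ := by rw [h0]; exact hd.len_pos h.edge
  have p1 : 0 < ‖v 1‖ := by rw [h1]; exact hd.len_pos h.swap₂₃.edge
  have p2 : 0 < ‖v 2‖ := by rw [h2]; exact hd.len_pos h.swap₃₄.swap₂₃.edge
  have hdet := (Matrix.posDef_gram_of_linearIndependent (𝕜 := ℝ) hv).det_pos
  rw [Matrix.det_fin_three] at hdet
  simp only [Matrix.gram_apply] at hdet
  rw [real_inner_comm (v 0) (v 1), real_inner_comm (v 0) (v 2), real_inner_comm (v 1) (v 2),
    inner_eq_mul_cos _ _ p0 p1, inner_eq_mul_cos _ _ p0 p2, inner_eq_mul_cos _ _ p1 p2,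
    real_inner_self_eq_norm_sq, real_inner_self_eq_norm_sq, real_inner_self_eq_norm_sq,
    h0, h1, h2, h01, h02, h12] at hdet
  change 0 < len d i j ^ 2 * len d i k ^ 2 * len d i l ^ 2
    - len d i j ^ 2 * (_ * faceCos d i k l) * (_ * faceCos d i k l)
    - _ * faceCos d i j k * (_ * faceCos d i j k) * _
    + _ * faceCos d i j k * (_ * faceCos d i k l) * (_ * faceCos d i j l)
    + _ * faceCos d i j l * (_ * faceCos d i j k) * (_ * faceCos d i k l)
    - _ * faceCos d i j l * _ * (_ * faceCos d i j l) at hdet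
  rw [h0] at p0
  rw [h1] at p1
  rw [h2] at p2
  have hp : 0 < (len d i j * len d i k * len d i l) ^ 2 := by positivity
  refine pos_of_mul_pos_right (lt_of_lt_of_eq hdet ?_) hp.le
  ring

theorem IsPreMetric.cos_faceAngle (hd : IsPreMetric K d) (h : IsTriangle K i j k) :
    Real.cos (faceAngle d i j k) = faceCos d i j k := by
  have := abs_lt.1 ((sq_lt_one_iff_abs_lt_one _).1 (hd.faceCos_sq_lt h))
  exact Real.cos_arccos this.1.le this.2.le

theorem IsPreMetric.sin_faceAngle_pos (hd : IsPreMetric K d) (h : IsTriangle K i j k) :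
    0 < Real.sin (faceAngle d i j k) := by
  change 0 < Real.sin (Real.arccos (faceCos d i j k))
  rw [Real.sin_arccos]
  exact Real.sqrt_pos.2 (by linarith [hd.faceCos_sq_lt h])

/-- The cosine of the dihedral angle at `{i, j}`, by the spherical law of cosines. -/
def dihedralCos (d : V → V → ℝ) (i j k l : V) : ℝ :=
  (Real.cos (faceAngle d i k l) - Real.cos (faceAngle d i j k) * Real.cos (faceAngle d i j l)) /
    (Real.sin (faceAngle d i j k) * Real.sin (faceAngle d i j l))

theorem IsPreMetric.dihedralCos_sq_lt (hd : IsPreMetric K d) (h : IsTetrahedron K i j k l) :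
    dihedralCos d i j k l ^ 2 < 1 := by
  have hs1 := hd.sin_faceAngle_pos h.triangle
  have hs2 := hd.sin_faceAngle_pos h.swap₃₄.triangle
  have hg := hd.gram_pos h
  rw [← hd.cos_faceAngle h.triangle, ← hd.cos_faceAngle h.swap₃₄.triangle,
    ← hd.cos_faceAngle h.swap₂₃.swap₃₄.triangle] at hg
  unfold dihedralCos
  rw [div_pow, div_lt_one (by positivity), mul_pow, Real.sin_sq, Real.sin_sq]
  nlinarith

theorem IsPreMetric.cos_dihedralAngle (hd : IsPreMetric K d) (h : IsTetrahedron K i j k l) :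
    Real.cos (dihedralAngle d i j k l) = dihedralCos d i j k l := by
  have := abs_lt.1 ((sq_lt_one_iff_abs_lt_one _).1 (hd.dihedralCos_sq_lt h))
  exact Real.cos_arccos this.1.le this.2.le

theorem IsPreMetric.sin_dihedralAngle_pos (hd : IsPreMetric K d) (h : IsTetrahedron K i j k l) :
    0 < Real.sin (dihedralAngle d i j k l) := by
  change 0 < Real.sin (Real.arccos (dihedralCos d i j k l))
  rw [Real.sin_arccos]
  exact Real.sqrt_pos.2 (by linarith [hd.dihedralCos_sq_lt h])

end Nondegenerate

end Nondegeneracy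

/-! ### Variation of angles -/

section Variation

/-- The derivative of an angle of a spherical triangle with sides `A`, `B`, `C`, opposite to `A`.
Here `w ^ 2` is the Gram determinant of the three vertices. -/
theorem hasDerivAt_spherical {A B C : ℝ → ℝ} {A' B' C' w t : ℝ}
    (hA : HasDerivAt A A' t) (hB : HasDerivAt B B' t) (hC : HasDerivAt C C' t)
    (hsB : 0 < Real.sin (B t)) (hsC : 0 < Real.sin (C t)) (hw : 0 < w)
    (hw2 : w ^ 2 = 1 - Real.cos (A t) ^ 2 - Real.cos (B t) ^ 2 - Real.cos (C t) ^ 2 +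
      2 * Real.cos (A t) * Real.cos (B t) * Real.cos (C t)) :
    HasDerivAt (fun s => Real.arccos ((Real.cos (A s) - Real.cos (C s) * Real.cos (B s)) /
        (Real.sin (C s) * Real.sin (B s))))
      (Real.sin (A t) / w * A' -
        (Real.cos (C t) - Real.cos (A t) * Real.cos (B t)) / (w * Real.sin (B t)) * B' -
        (Real.cos (B t) - Real.cos (A t) * Real.cos (C t)) / (w * Real.sin (C t)) * C') t := by
  have hq := ((hA.cos.sub (hC.cos.mul hB.cos)).div (hC.sin.mul hB.sin)
    (mul_pos hsC hsB).ne')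
  have e1 := Real.sin_sq_add_cos_sq (B t)
  have e2 := Real.sin_sq_add_cos_sq (C t)
  -- This evaluates the square root in the derivative of `arccos`: the sine of the angle is `w /
  -- (sin C * sin B)`.
  have hy : 1 - ((Real.cos (A t) - Real.cos (C t) * Real.cos (B t)) /
      (Real.sin (C t) * Real.sin (B t))) ^ 2 = (w / (Real.sin (C t) * Real.sin (B t))) ^ 2 := by
    rw [div_pow, div_pow, hw2, eq_div_iff (by positivity), sub_mul,
      div_mul_cancel₀ _ (by positivity), mul_pow, Real.sin_sq, Real.sin_sq]
    ring
  have hpos : 0 < w / (Real.sin (C t) * Real.sin (B t)) := by positivity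
  have hlt : ((Real.cos (A t) - Real.cos (C t) * Real.cos (B t)) /
      (Real.sin (C t) * Real.sin (B t))) ^ 2 < 1 := by nlinarith [sq_pos_of_pos hpos]
  have habs := abs_lt.1 ((sq_lt_one_iff_abs_lt_one _).1 hlt)
  have h := (Real.hasDerivAt_arccos habs.1.ne' habs.2.ne).comp t hq
  rw [hy, Real.sqrt_sq hpos.le] at h
  refine h.congr_deriv ?_
  simp only [Pi.mul_apply, Pi.sub_apply]
  field_simp
  linear_combination (-Real.sin (B t) * Real.cos (B t) * C') * e2 -
    (Real.sin (C t) * Real.cos (C t) * B') * e1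

variable {V : Type*} [DecidableEq V] {K : AbstractSimplicialComplex V} {D : ℝ → V → V → ℝ}
  {x : V → ℝ} {i j k l : V}

/-- To first order at `0`, the curve `D` of metrics is the conformal variation in the
direction `x`. -/
def IsConformalCurve (K : AbstractSimplicialComplex V) (D : ℝ → V → V → ℝ) (x : V → ℝ) : Prop :=
  ∀ i j, IsEdge K i j → HasDerivAt (fun s => len (D s) i j) (D 0 i j * x i + D 0 j i * x j) 0

theorem IsConformalCurve.hasDerivAt_faceAngle (hD : IsConformalCurve K D x) (hd : D 0 ∈ met K)
    (h : IsTriangle K i j k) :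
    HasDerivAt (fun s => faceAngle (D s) i j k)
      (triHeight (D 0) i j k / len (D 0) i j * (x j - x i) +
        triHeight (D 0) i k j / len (D 0) i k * (x k - x i)) 0 := by
  have hcyc := hd.2 i j k h
  have ha := hD i j h.edge
  have hb := hD i k h.swap₂₃.edge
  have hc := hD j k h.swap₁₂.swap₂₃.edge
  have pa := hd.1.len_pos h.edge
  have pb := hd.1.len_pos h.swap₂₃.edge
  have hs := hd.1.sin_faceAngle_pos h
  have hcos := hd.1.cos_faceAngle h
  have hlt := hd.1.faceCos_sq_lt h
  have habs := abs_lt.1 ((sq_lt_one_iff_abs_lt_one _).1 hlt)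
  have hq : HasDerivAt (fun s => faceCos (D s) i j k) _ 0 :=
    (((ha.pow 2).add (hb.pow 2)).sub (hc.pow 2)).div ((ha.const_mul 2).mul hb)
      (by simp only [ne_eq]; positivity)
  have hsin : Real.sqrt (1 - faceCos (D 0) i j k ^ 2) = Real.sin (faceAngle (D 0) i j k) :=
    (Real.sin_arccos _).symm
  have hder := (Real.hasDerivAt_arccos habs.1.ne' habs.2.ne).comp 0 hq
  rw [hsin] at hder
  refine hder.congr_deriv ?_
  unfold triHeight
  rw [faceAngle_comm (D 0) i k j]
  simp only [Pi.sub_apply, Pi.add_apply, Pi.pow_apply]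
  have hq2 : 2 * len (D 0) i j * len (D 0) i k * Real.cos (faceAngle (D 0) i j k) =
      len (D 0) i j ^ 2 + len (D 0) i k ^ 2 - len (D 0) j k ^ 2 := by
    rw [hcos]; unfold faceCos; field_simp
  rw [← hq2]
  generalize Real.cos (faceAngle (D 0) i j k) = q at *
  generalize Real.sin (faceAngle (D 0) i j k) = S at *
  clear hcos hder hsin hlt habs hq hc ha hb
  unfold len at *
  field_simp
  push_cast
  -- The law of cosines alone does not suffice: the identity between the squares of the `d`'s around
  -- the triangle is needed to produce the heights.
  linear_combination (x j + x k) * hq2 + (x j - x k) * hcyc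

theorem IsPreMetric.exists_sqrt_gram {d : V → V → ℝ} (hd : IsPreMetric K d)
    (h : IsTetrahedron K i j k l) :
    ∃ w : ℝ, 0 < w ∧ w ^ 2 = 1 - Real.cos (faceAngle d i j k) ^ 2 -
      Real.cos (faceAngle d i j l) ^ 2 -
      Real.cos (faceAngle d i k l) ^ 2 +
      2 * Real.cos (faceAngle d i j k) * Real.cos (faceAngle d i j l) *
        Real.cos (faceAngle d i k l) := by
  have hg := hd.gram_pos h
  rw [← hd.cos_faceAngle h.triangle, ← hd.cos_faceAngle h.swap₃₄.triangle,
    ← hd.cos_faceAngle h.swap₂₃.swap₃₄.triangle] at hg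
  exact ⟨_, Real.sqrt_pos.2 hg, Real.sq_sqrt hg.le⟩

/-- The quantity `w` is symmetric in the three edges at `i`, so this form gives all the tetrahedron
heights at the faces through `i` in terms of one `w`, ready for comparison with
`hasDerivAt_spherical`. -/
theorem IsPreMetric.tetHeight_eq {d : V → V → ℝ} (hd : IsPreMetric K d)
    (h : IsTetrahedron K i j k l) {w : ℝ} (hw : 0 < w)
    (hw2 : w ^ 2 = 1 - Real.cos (faceAngle d i j k) ^ 2 -
      Real.cos (faceAngle d i j l) ^ 2 -
      Real.cos (faceAngle d i k l) ^ 2 +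
      2 * Real.cos (faceAngle d i j k) * Real.cos (faceAngle d i j l) *
        Real.cos (faceAngle d i k l)) :
    tetHeight d i j k l =
      (d i l * Real.sin (faceAngle d i j k) ^ 2 -
        d i j * (Real.cos (faceAngle d i j l) -
          Real.cos (faceAngle d i k l) * Real.cos (faceAngle d i j k)) -
        d i k * (Real.cos (faceAngle d i k l) -
          Real.cos (faceAngle d i j l) *
            Real.cos (faceAngle d i j k))) /
      (w * Real.sin (faceAngle d i j k)) := by
  have hsC := hd.sin_faceAngle_pos h.triangle
  have hsB := hd.sin_faceAngle_pos h.swap₃₄.triangle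
  have e1 := Real.sin_sq_add_cos_sq (faceAngle d i j k)
  have e2 := Real.sin_sq_add_cos_sq (faceAngle d i j l)
  have hsin : Real.sin (dihedralAngle d i j k l) =
      w / (Real.sin (faceAngle d i j k) *
        Real.sin (faceAngle d i j l)) := by
    rw [← sq_eq_sq₀ (hd.sin_dihedralAngle_pos h).le (by positivity), Real.sin_sq,
      hd.cos_dihedralAngle h, dihedralCos, div_pow, div_pow, hw2, eq_div_iff (by positivity),
      sub_mul, div_mul_cancel₀ _ (by positivity), mul_pow, Real.sin_sq, Real.sin_sq]
    ring
  unfold tetHeight triHeight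
  rw [hsin, hd.cos_dihedralAngle h, dihedralCos]
  field_simp
  linear_combination (-d i j * Real.cos (faceAngle d i j l)) * e1

/-- The variation of the dihedral angles at the vertex `i` of a tetrahedron under a conformal
variation. -/
theorem IsConformalCurve.hasDerivAt_dihedralAngle (hD : IsConformalCurve K D x) (hd : D 0 ∈ met K)
    (h : IsTetrahedron K i j k l) :
    ∃ β₁ β₂ β₃ : ℝ, HasDerivAt (fun s => dihedralAngle (D s) i j k l) β₁ 0 ∧
      HasDerivAt (fun s => dihedralAngle (D s) i k l j) β₂ 0 ∧
      HasDerivAt (fun s => dihedralAngle (D s) i l j k) β₃ 0 ∧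
      D 0 i j * β₁ + D 0 i k * β₂ + D 0 i l * β₃ =
        2 * dualArea (D 0) i j k l / len (D 0) i j * (x j - x i) +
        2 * dualArea (D 0) i k l j / len (D 0) i k * (x k - x i) +
        2 * dualArea (D 0) i l j k / len (D 0) i l * (x l - x i) := by
  obtain ⟨w, hw, hw2⟩ := hd.1.exists_sqrt_gram h
  have tC := h.triangle
  have tB := h.swap₃₄.triangle
  have tA := h.swap₂₃.swap₃₄.triangle
  have hsA := hd.1.sin_faceAngle_pos tA
  have hsB := hd.1.sin_faceAngle_pos tB
  have hsC := hd.1.sin_faceAngle_pos tC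
  have hA := hD.hasDerivAt_faceAngle hd tA
  have hB := hD.hasDerivAt_faceAngle hd tB
  have hC := hD.hasDerivAt_faceAngle hd tC
  have cA : ∀ s, faceAngle (D s) i l k = faceAngle (D s) i k l :=
    fun s => faceAngle_comm _ _ _ _
  have cB : ∀ s, faceAngle (D s) i l j = faceAngle (D s) i j l :=
    fun s => faceAngle_comm _ _ _ _
  have cC : ∀ s, faceAngle (D s) i k j = faceAngle (D s) i j k :=
    fun s => faceAngle_comm _ _ _ _
  have h₁ := hasDerivAt_spherical hA hB hC hsB hsC hw (by rw [hw2]; ring)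
  have h₂ := hasDerivAt_spherical hB hC hA hsC hsA hw (by rw [hw2]; ring)
  have h₃ := hasDerivAt_spherical hC hA hB hsA hsB hw (by rw [hw2]; ring)
  have g₂ := h₂.congr_of_eventuallyEq (f₁ := fun s => dihedralAngle (D s) i k l j)
    (.of_forall fun s => by simp only [dihedralAngle, cB, cC])
  have g₃ := h₃.congr_of_eventuallyEq (f₁ := fun s => dihedralAngle (D s) i l j k)
    (.of_forall fun s => by simp only [dihedralAngle, cA, cB])
  refine ⟨_, _, _, h₁, g₂, g₃, ?_⟩
  -- In the weighted sum of the three derivatives, the coefficient of each face angle's derivative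
  -- is the tetrahedron height over that face. Inserting the derivatives of the face angles then
  -- gives products of heights, that is, dual areas. The face heights enter linearly and can be
  -- treated as free variables.
  have t1 := hd.1.tetHeight_eq h hw hw2
  have t2 := hd.1.tetHeight_eq h.swap₃₄ hw (by rw [cA, hw2]; ring)
  have t3 := hd.1.tetHeight_eq h.swap₂₃.swap₃₄ hw (by rw [cB, cC, hw2]; ring)
  have t1' := hd.1.tetHeight_eq h.swap₂₃ hw (by rw [cC, hw2]; ring)
  have t2' := hd.1.tetHeight_eq h.swap₃₄.swap₂₃ hw (by rw [cA, cB, hw2]; ring)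
  have t3' := hd.1.tetHeight_eq h.swap₂₃.swap₃₄.swap₂₃ hw (by rw [cA, cB, cC, hw2]; ring)
  simp only [cA, cB, cC] at t1 t2 t3 t1' t2' t3'
  unfold dualArea
  rw [t1', t2', t3', t1, t2, t3]
  have pa := hd.1.len_pos h.edge
  have pb := hd.1.len_pos h.swap₂₃.edge
  have pc := hd.1.len_pos h.swap₃₄.swap₂₃.edge
  generalize triHeight (D 0) i j k = h1
  generalize triHeight (D 0) i k j = h2
  generalize triHeight (D 0) i j l = h3
  generalize triHeight (D 0) i l j = h4
  generalize triHeight (D 0) i k l = h5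
  generalize triHeight (D 0) i l k = h6
  field_simp
  ring

end Variation

/-! ### Variation of the scalar curvature -/

section ScalarCurvature

variable {V : Type*} [Fintype V] [DecidableEq V] {K : AbstractSimplicialComplex V}
  {D : ℝ → V → V → ℝ} {x : V → ℝ}

omit [DecidableEq V] in
-- Rotating the indices does not change a full sum. This is needed because the variation of the
-- dihedral angles is known only summed over the three edges at a vertex.
theorem sum_eq_sum_of_cyclic {F G : V → V → V → ℝ}
    (h : ∀ j k l, F j k l + F k l j + F l j k = G j k l + G k l j + G l j k) :
    ∑ j, ∑ k, ∑ l, F j k l = ∑ j, ∑ k, ∑ l, G j k l := by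
  have rot : ∀ H : V → V → V → ℝ, ∑ j, ∑ k, ∑ l, H k l j = ∑ j, ∑ k, ∑ l, H j k l := fun H => by
    rw [Finset.sum_comm]
    refine Finset.sum_congr rfl fun k _ => ?_
    rw [Finset.sum_comm]
  have tot : ∀ H : V → V → V → ℝ,
      ∑ j, ∑ k, ∑ l, (H j k l + H k l j + H l j k) = 3 * ∑ j, ∑ k, ∑ l, H j k l := fun H => by
    simp only [Finset.sum_add_distrib]
    rw [rot H, ← rot (fun j k l => H l j k)]
    ring
  have := tot F
  rw [show (∑ j, ∑ k, ∑ l, (F j k l + F k l j + F l j k)) = 3 * ∑ j, ∑ k, ∑ l, G j k l by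
    rw [← tot G]; simp only [h]] at this
  linarith

theorem deficit_eq_zero {d : V → V → ℝ} (hd : IsPreMetric K d) (hflat : IsRicciFlat K d) {i j : V}
    (h : IsEdge K i j) : deficit K d i j = 0 :=
  (mul_eq_zero.1 (hflat i j h)).resolve_right (hd.len_pos h).ne'

open scoped Classical in
/-- The graph Laplacian with the weights `2 * ℓ*_ij / ℓ_ij`. -/
def dualLaplacian (K : AbstractSimplicialComplex V) (d : V → V → ℝ) (x : V → ℝ) (i : V) : ℝ :=
  ∑ j, if IsEdge K i j then 2 * dualLength K d i j / len d i j * (x j - x i) else 0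

open scoped Classical in
-- The factor `2` in the weights cancels the `1 / 2` that compensates for ordered pairs in
-- `sumTetrahedra`.
theorem dualLaplacian_eq_sum_tetrahedra (K : AbstractSimplicialComplex V) (d : V → V → ℝ)
    (x : V → ℝ) (i : V) :
    dualLaplacian K d x i = ∑ j, ∑ k, ∑ l, if IsTetrahedron K i j k l then
      dualArea d i j k l / len d i j * (x j - x i) else 0 := by
  refine Finset.sum_congr rfl fun j _ => ?_
  split_ifs with h
  · unfold dualLength sumTetrahedra
    rw [← mul_assoc, mul_one_div_cancel two_ne_zero, one_mul, Finset.sum_div, Finset.sum_mul]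
    refine Finset.sum_congr rfl fun k _ => ?_
    rw [Finset.sum_div, Finset.sum_mul]
    refine Finset.sum_congr rfl fun l _ => ?_
    split_ifs <;> ring
  · symm
    exact Finset.sum_eq_zero fun k _ => Finset.sum_eq_zero fun l _ => if_neg fun ht => h ht.edge

open scoped Classical in
/-- The variation of the scalar curvature at a Ricci flat metric under a conformal variation is a
weighted graph Laplacian. -/
theorem IsConformalCurve.hasDerivAt_scalarCurvature (hD : IsConformalCurve K D x)
    (hD' : ∀ i j, IsEdge K i j → DifferentiableAt ℝ (fun s => D s i j) 0)
    (hd : D 0 ∈ met K) (hflat : IsRicciFlat K (D 0)) (i : V) :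
    HasDerivAt (fun s => scalarCurvature K (D s) i)
      (-dualLaplacian K (D 0) x i) 0 := by
  set β' : V → V → V → ℝ := fun j k l => deriv (fun s => dihedralAngle (D s) i j k l) 0 with hβ
  have hβ' : ∀ j k l, IsTetrahedron K i j k l →
      HasDerivAt (fun s => dihedralAngle (D s) i j k l) (β' j k l) 0 := fun j k l h => by
    obtain ⟨_, _, _, h₁, -⟩ := hD.hasDerivAt_dihedralAngle hd h
    exact h₁.differentiableAt.hasDerivAt
  have hdef : ∀ j, HasDerivAt (fun s => deficit K (D s) i j)
      (-((1 / 2) * ∑ k, ∑ l, if IsTetrahedron K i j k l then β' j k l else 0)) 0 := fun j => by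
    unfold deficit sumTetrahedra
    refine HasDerivAt.const_sub _ (HasDerivAt.const_mul _ ?_)
    refine HasDerivAt.fun_sum fun k _ => HasDerivAt.fun_sum fun l _ => ?_
    split_ifs with h
    · exact hβ' j k l h
    · exact hasDerivAt_const _ _
  have hmain : HasDerivAt (fun s => scalarCurvature K (D s) i)
      (∑ j, if IsEdge K i j then
        -((1 / 2) * ∑ k, ∑ l, if IsTetrahedron K i j k l then β' j k l else 0) * D 0 i j
        else 0) 0 := by
    unfold scalarCurvature
    refine HasDerivAt.fun_sum fun j _ => ?_
    split_ifs with h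
    · refine ((hdef j).mul (hD' i j h).hasDerivAt).congr_deriv ?_
      -- Ricci flatness removes the term with the derivative of `d_ij` itself, which a conformal
      -- variation does not determine.
      rw [deficit_eq_zero hd.1 hflat h, zero_mul, add_zero]
    · exact hasDerivAt_const _ _
  refine hmain.congr_deriv ?_
  have key := sum_eq_sum_of_cyclic
    (F := fun j k l => if IsTetrahedron K i j k l then D 0 i j * β' j k l else 0)
    (G := fun j k l => if IsTetrahedron K i j k l then
      2 * dualArea (D 0) i j k l / len (D 0) i j * (x j - x i) else 0) (fun j k l => by
      by_cases h : IsTetrahedron K i j k l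
      · rw [if_pos h, if_pos h.rotate, if_pos h.rotate.rotate, if_pos h, if_pos h.rotate,
          if_pos h.rotate.rotate]
        obtain ⟨b₁, b₂, b₃, h₁, h₂, h₃, e⟩ := hD.hasDerivAt_dihedralAngle hd h
        rw [hβ]
        simp only [h₁.deriv, h₂.deriv, h₃.deriv]
        exact e
      · have h' : ¬ IsTetrahedron K i k l j := fun hh => h hh.rotate.rotate
        have h'' : ¬ IsTetrahedron K i l j k := fun hh => h hh.rotate
        simp only [if_neg h, if_neg h', if_neg h''])
  have e1 : ∀ j, (if IsEdge K i j then
      -((1 / 2) * ∑ k, ∑ l, if IsTetrahedron K i j k l then β' j k l else 0) * D 0 i j else 0) =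
      -(1 / 2) * ∑ k, ∑ l, if IsTetrahedron K i j k l then D 0 i j * β' j k l else 0 := fun j => by
    split_ifs with h
    · rw [neg_mul, neg_mul, mul_assoc, Finset.sum_mul]
      congr 2
      refine Finset.sum_congr rfl fun k _ => ?_
      rw [Finset.sum_mul]
      refine Finset.sum_congr rfl fun l _ => ?_
      split_ifs <;> ring
    · rw [Finset.sum_eq_zero, mul_zero]
      intro k _
      exact Finset.sum_eq_zero fun l _ => if_neg fun ht => h ht.edge
  simp only [e1]
  rw [← Finset.mul_sum, key, dualLaplacian_eq_sum_tetrahedra, Finset.mul_sum,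
    ← Finset.sum_neg_distrib]
  refine Finset.sum_congr rfl fun j _ => ?_
  rw [Finset.mul_sum, ← Finset.sum_neg_distrib]
  refine Finset.sum_congr rfl fun k _ => ?_
  rw [Finset.mul_sum, ← Finset.sum_neg_distrib]
  refine Finset.sum_congr rfl fun l _ => ?_
  split_ifs <;> ring

end ScalarCurvature

/-! ### Sphere packing metrics -/

section PackingForm

/-- Four times the squared curvature of the sphere through the points of tangency of four mutually
tangent spheres with curvatures `a`, `b`, `c`, `t`. -/
def packDelta (a b c t : ℝ) : ℝ := (a + b + c + t) ^ 2 - 2 * (a ^ 2 + b ^ 2 + c ^ 2 + t ^ 2)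

/-- The numerator of `packWeight`. -/
def packNum (a b c t : ℝ) : ℝ := 2 * a * b + (a + b) * (c + t) - (c - t) ^ 2

/-- The weight of the edge between the spheres with curvatures `a` and `b`, up to a factor which is
symmetric in the four spheres. -/
def packWeight (a b c t : ℝ) : ℝ :=
  a * b * packNum a b c t / ((a * b + a * c + b * c) * (a * b + a * t + b * t))

/-- The quadratic form with the weights `packWeight`. -/
def packForm (a b c t x y z w : ℝ) : ℝ :=
  packWeight a b c t * (x - y) ^ 2 + packWeight a c b t * (x - z) ^ 2 +
    packWeight a t b c * (x - w) ^ 2 + packWeight b c a t * (y - z) ^ 2 +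
    packWeight b t a c * (y - w) ^ 2 + packWeight c t a b * (z - w) ^ 2

theorem packDelta_swap₁₂ (a b c t : ℝ) : packDelta b a c t = packDelta a b c t := by
  unfold packDelta; ring

theorem packDelta_swap₂₃ (a b c t : ℝ) : packDelta a c b t = packDelta a b c t := by
  unfold packDelta; ring

theorem packDelta_swap₃₄ (a b c t : ℝ) : packDelta a b t c = packDelta a b c t := by
  unfold packDelta; ring

theorem packWeight_swap₁₂ (a b c t : ℝ) : packWeight b a c t = packWeight a b c t := by
  unfold packWeight packNum; ring

theorem packWeight_swap₃₄ (a b c t : ℝ) : packWeight a b t c = packWeight a b c t := by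
  unfold packWeight packNum
  rw [mul_comm (a * b + a * t + b * t)]
  ring

theorem packForm_swap₁₂ (a b c t x y z w : ℝ) :
    packForm b a c t y x z w = packForm a b c t x y z w := by
  unfold packForm
  rw [packWeight_swap₁₂ a b, packWeight_swap₃₄ c t a b]
  ring

theorem packForm_swap₂₃ (a b c t x y z w : ℝ) :
    packForm a c b t x z y w = packForm a b c t x y z w := by
  unfold packForm
  rw [packWeight_swap₁₂ b c, packWeight_swap₃₄ a t b c]
  ring

theorem packForm_swap₃₄ (a b c t x y z w : ℝ) :
    packForm a b t c x y w z = packForm a b c t x y z w := by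
  unfold packForm
  rw [packWeight_swap₁₂ c t, packWeight_swap₃₄ a b c t]
  ring

variable {a b c t : ℝ}

theorem packWeight_pos (ha : 0 < a) (hb : 0 < b) (hc : 0 < c) (ht : 0 < t)
    (h : 0 < packNum a b c t) : 0 < packWeight a b c t := by
  unfold packWeight; positivity

/-- Since `b` and `c` lie between `0` and `t`, `(b - c) ^ 2 ≤ t * (b + c)`. Edges at the smallest
sphere thus have positive weight. -/
theorem packNum_pos_of_le (ha : 0 < a) (hb : 0 < b) (hc : 0 < c) (hbt : b ≤ t) (hct : c ≤ t) :
    0 < packNum a t b c := by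
  have ht : 0 < t := hb.trans_le hbt
  have h : (b - c) ^ 2 ≤ t * (b + c) := by nlinarith [mul_pos hb hc]
  have : 0 < a * t + a * (b + c) := by positivity
  unfold packNum
  nlinarith

theorem two_mul_packNum (a b c t : ℝ) :
    2 * packNum a b c t = packDelta a b c t + (a + b + t - c) * (a + b + c - t) := by
  unfold packNum packDelta; ring

/-- This is the numerator of the sum in `packWeight_schur_pos`, up to a positive factor, in the
range `t ≥ a + b + c` where the weight of the edge `a b` may be negative. -/
theorem packNum_schur_pos (ha : 0 < a) (hb : 0 < b) (hc : 0 < c) {n : ℝ} (hn : 0 ≤ n)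
    (hΔ : 0 < 4 * (a * b + b * c + c * a) - n ^ 2) (ht : t = a + b + c + n) :
    0 < packNum a b c t *
      (a * packNum a t b c * (b * c + b * t + c * t) +
        b * packNum b t a c * (a * c + a * t + c * t) +
        c * packNum c t a b * (a * b + a * t + b * t)) +
      t * packNum a t b c * packNum b t a c * (a * b + a * c + b * c) := by
  -- After substituting `t = a + b + c + n`, the first factor is `packDelta a b c t`. The quantity
  -- is divisible by it, and the quotient has only positive coefficients.
  have hpos : 0 < (4 * (a * b + b * c + c * a) - n ^ 2) * (
      3 * b * c ^ 2 * n ^ 2 + 4 * b * c ^ 3 * n + b * c ^ 4 + 3 * b ^ 2 * c * n ^ 2 + 14 * b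
      ^ 2 * c ^ 2 * n + 9 * b ^ 2 * c ^ 3 + 6 * b ^ 3 * c * n + 11 * b ^ 3 * c ^ 2 + 3 * b ^
      4 * c + 3 * a * c ^ 2 * n ^ 2 + 4 * a * c ^ 3 * n + a * c ^ 4 + 6 * a * b * c * n ^ 2 +
      31 * a * b * c ^ 2 * n + 19 * a * b * c ^ 3 + 3 * a * b ^ 2 * n ^ 2 + 31 * a * b ^ 2 *
      c * n + 48 * a * b ^ 2 * c ^ 2 + 6 * a * b ^ 3 * n + 25 * a * b ^ 3 * c + 3 * a * b ^ 4
      + 3 * a ^ 2 * c * n ^ 2 + 14 * a ^ 2 * c ^ 2 * n + 9 * a ^ 2 * c ^ 3 + 3 * a ^ 2 * b *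
      n ^ 2 + 31 * a ^ 2 * b * c * n + 48 * a ^ 2 * b * c ^ 2 + 15 * a ^ 2 * b ^ 2 * n + 51 *
      a ^ 2 * b ^ 2 * c + 12 * a ^ 2 * b ^ 3 + 6 * a ^ 3 * c * n + 11 * a ^ 3 * c ^ 2 + 6 * a
      ^ 3 * b * n + 25 * a ^ 3 * b * c + 12 * a ^ 3 * b ^ 2 + 3 * a ^ 4 * c + 3 * a ^ 4 * b) :=
    mul_pos hΔ (by positivity)
  refine lt_of_lt_of_eq hpos ?_
  subst ht
  unfold packNum
  ring

/-- Divided by the sum of the weights at `t`, this is the weight of the edge `a b` after the vertex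
`t` has been eliminated (star-triangle transformation). -/
theorem packWeight_schur_pos (ha : 0 < a) (hb : 0 < b) (hc : 0 < c) (hat : a ≤ t) (hbt : b ≤ t)
    (hct : c ≤ t) (hΔ : 0 < packDelta a b c t) :
    0 < packWeight a b c t * (packWeight a t b c + packWeight b t a c + packWeight c t a b) +
      packWeight a t b c * packWeight b t a c := by
  have ht : 0 < t := ha.trans_le hat
  have h1 := packWeight_pos ha ht hb hc (packNum_pos_of_le ha hb hc hbt hct)
  have h2 := packWeight_pos hb ht ha hc (packNum_pos_of_le hb ha hc hat hct)
  have h3 := packWeight_pos hc ht ha hb (packNum_pos_of_le hc ha hb hat hbt)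
  rcases le_total t (a + b + c) with h | h
  · have : 0 < packNum a b c t := by
      have := two_mul_packNum a b c t
      have : 0 ≤ (a + b + t - c) * (a + b + c - t) :=
        mul_nonneg (by linarith) (by linarith)
      linarith
    have h0 := packWeight_pos ha hb hc ht this
    positivity
  · have := packNum_schur_pos ha hb hc (t := t) (n := t - (a + b + c)) (by linarith)
      (by unfold packDelta at hΔ; nlinarith) (by ring)
    have hp : 0 < a * b * t / ((b * c + b * t + c * t) * (a * c + a * t + c * t) *
      (a * b + a * t + b * t) ^ 2 * (a * b + a * c + b * c)) := by positivity
    refine lt_of_lt_of_eq (mul_pos hp this) ?_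
    unfold packWeight
    generalize packNum a b c t = n0
    generalize packNum a t b c = n1
    generalize packNum b t a c = n2
    generalize packNum c t a b = n3
    have p1 : b * c + b * t + c * t ≠ 0 := by positivity
    have p2 : a * c + a * t + c * t ≠ 0 := by positivity
    have p3 : a * b + a * t + b * t ≠ 0 := by positivity
    have p4 : a * b + a * c + b * c ≠ 0 := by positivity
    rw [show (a * t + a * b + t * b) = a * b + a * t + b * t by ring,
      show (a * t + a * c + t * c) = a * c + a * t + c * t by ring,
      show (b * t + b * a + t * a) = a * b + a * t + b * t by ring,
      show (b * t + b * c + t * c) = b * c + b * t + c * t by ring,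
      show (c * t + c * a + t * a) = a * c + a * t + c * t by ring,
      show (c * t + c * b + t * b) = b * c + b * t + c * t by ring]
    generalize b * c + b * t + c * t = E1 at *
    generalize a * c + a * t + c * t = E2 at *
    generalize a * b + a * t + b * t = E3 at *
    generalize a * b + a * c + b * c = E4 at *
    field_simp

theorem packForm_of_le (ha : 0 < a) (hb : 0 < b) (hc : 0 < c) (hat : a ≤ t) (hbt : b ≤ t)
    (hct : c ≤ t) (hΔ : 0 < packDelta a b c t) (x y z w : ℝ) :
    0 ≤ packForm a b c t x y z w ∧
      (packForm a b c t x y z w = 0 → x = y ∧ x = z ∧ x = w) := by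
  have ht : 0 < t := ha.trans_le hat
  have h1 := packWeight_pos ha ht hb hc (packNum_pos_of_le ha hb hc hbt hct)
  have h2 := packWeight_pos hb ht ha hc (packNum_pos_of_le hb ha hc hat hct)
  have h3 := packWeight_pos hc ht ha hb (packNum_pos_of_le hc ha hb hat hbt)
  have k12 := packWeight_schur_pos ha hb hc hat hbt hct hΔ
  have k13 := packWeight_schur_pos ha hc hb hat hct hbt (by rwa [packDelta_swap₂₃])
  have k23 := packWeight_schur_pos hb hc ha hbt hct hat
    (by rwa [packDelta_swap₂₃, packDelta_swap₁₂])
  rw [packWeight_swap₃₄ a t b c] at k13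
  rw [packWeight_swap₃₄ b t a c, packWeight_swap₃₄ c t a b] at k23
  unfold packForm
  generalize packWeight a t b c = c1 at *
  generalize packWeight b t a c = c2 at *
  generalize packWeight c t a b = c3 at *
  generalize packWeight a b c t = w12 at *
  generalize packWeight a c b t = w13 at *
  generalize packWeight b c a t = w23 at *
  have hs : 0 < c1 + c2 + c3 := by positivity
  -- Completing the square in `w`, the variable of the largest curvature, leaves a form in the
  -- differences of `x`, `y`, `z` whose weights are positive by `packWeight_schur_pos`.
  have id : (c1 + c2 + c3) * (w12 * (x - y) ^ 2 + w13 * (x - z) ^ 2 + c1 * (x - w) ^ 2 +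
      w23 * (y - z) ^ 2 + c2 * (y - w) ^ 2 + c3 * (z - w) ^ 2) =
      (c1 * (x - w) + c2 * (y - w) + c3 * (z - w)) ^ 2 +
      (w12 * (c1 + c2 + c3) + c1 * c2) * (x - y) ^ 2 +
      (w13 * (c1 + c3 + c2) + c1 * c3) * (x - z) ^ 2 +
      (w23 * (c2 + c3 + c1) + c2 * c3) * (y - z) ^ 2 := by ring
  have i1 := mul_nonneg k12.le (sq_nonneg (x - y))
  have i2 := mul_nonneg k13.le (sq_nonneg (x - z))
  have i3 := mul_nonneg k23.le (sq_nonneg (y - z))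
  have i4 := sq_nonneg (c1 * (x - w) + c2 * (y - w) + c3 * (z - w))
  refine ⟨nonneg_of_mul_nonneg_right (id ▸ by positivity) hs, fun h0 => ?_⟩
  rw [h0, mul_zero] at id
  have e1 : x - y = 0 := by
    have : (w12 * (c1 + c2 + c3) + c1 * c2) * (x - y) ^ 2 = 0 := by linarith
    simpa [k12.ne'] using this
  have e2 : x - z = 0 := by
    have : (w13 * (c1 + c3 + c2) + c1 * c3) * (x - z) ^ 2 = 0 := by linarith
    simpa [k13.ne'] using this
  obtain rfl : x = y := by linarith
  obtain rfl : x = z := by linarith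
  have e3 : (c1 * (x - w) + c2 * (x - w) + c3 * (x - w)) ^ 2 = 0 := by linarith
  have : (c1 + c2 + c3) * (x - w) = 0 := by
    rw [← pow_eq_zero_iff two_ne_zero, ← e3]; ring
  refine ⟨rfl, rfl, ?_⟩
  have := (mul_eq_zero.1 this).resolve_left hs.ne'
  linarith

/-- The form of four mutually tangent spheres is positive semidefinite, and its kernel consists of
the constants. -/
theorem packForm_nonneg (ha : 0 < a) (hb : 0 < b) (hc : 0 < c) (ht : 0 < t)
    (hΔ : 0 < packDelta a b c t) (x y z w : ℝ) :
    0 ≤ packForm a b c t x y z w ∧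
      (packForm a b c t x y z w = 0 → x = y ∧ x = z ∧ x = w) := by
  -- By symmetry the largest curvature can be moved to the last place.
  by_cases h1 : a ≤ t ∧ b ≤ t ∧ c ≤ t
  · exact packForm_of_le ha hb hc h1.1 h1.2.1 h1.2.2 hΔ x y z w
  by_cases h2 : a ≤ c ∧ b ≤ c ∧ t ≤ c
  · have := packForm_of_le ha hb ht h2.1 h2.2.1 h2.2.2 (by rwa [packDelta_swap₃₄]) x y w z
    rw [packForm_swap₃₄] at this
    exact ⟨this.1, fun h => by have := this.2 h; tauto⟩
  by_cases h3 : a ≤ b ∧ c ≤ b ∧ t ≤ b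
  · have := packForm_of_le ha hc ht h3.1 h3.2.1 h3.2.2
      (by rwa [packDelta_swap₃₄, packDelta_swap₂₃]) x z w y
    rw [packForm_swap₃₄, packForm_swap₂₃] at this
    exact ⟨this.1, fun h => by have := this.2 h; tauto⟩
  have h4 : b ≤ a ∧ c ≤ a ∧ t ≤ a := by grind
  have := packForm_of_le hb hc ht h4.1 h4.2.1 h4.2.2
    (by rwa [packDelta_swap₃₄, packDelta_swap₂₃, packDelta_swap₁₂]) y z w x
  rw [packForm_swap₃₄, packForm_swap₂₃, packForm_swap₁₂] at this
  exact ⟨this.1, fun h => by have := this.2 h; grind⟩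

end PackingForm

/-! ### Angles, heights and dual areas in terms of the curvatures of the spheres. -/

section PackingMetric

variable {V : Type*} [DecidableEq V] {K : AbstractSimplicialComplex V} {d : V → V → ℝ}
  {κ : V → ℝ} {i j k l : V}

/-- `d` is the metric of a sphere packing in which the spheres have the curvatures `κ`. -/
def IsPackingMetric (K : AbstractSimplicialComplex V) (d : V → V → ℝ) (κ : V → ℝ) : Prop :=
  (∀ i, 0 < κ i) ∧ ∀ i j, IsEdge K i j → d i j = (κ i)⁻¹

/-- The squared inverse inradius of a triangle with vertices `i`, `j`, `k`. -/
def packTri (κ : V → ℝ) (i j k : V) : ℝ := κ i * κ j + κ i * κ k + κ j * κ k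

omit [DecidableEq V] in
theorem packTri_pos (hκ : ∀ i, 0 < κ i) (i j k : V) : 0 < packTri κ i j k := by
  have := hκ i
  have := hκ j
  have := hκ k
  unfold packTri
  positivity

theorem IsPackingMetric.len_eq (h : IsPackingMetric K d κ) (e : IsEdge K i j) :
    len d i j = (κ i)⁻¹ + (κ j)⁻¹ := by
  rw [len, h.2 i j e, h.2 j i e.symm]

theorem IsPackingMetric.cos_faceAngle (h : IsPackingMetric K d κ) (hd : IsPreMetric K d)
    (ht : IsTriangle K i j k) :
    Real.cos (faceAngle d i j k) = 1 - 2 * κ i ^ 2 / ((κ i + κ j) * (κ i + κ k)) := by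
  rw [hd.cos_faceAngle ht, faceCos, h.len_eq ht.edge, h.len_eq ht.swap₂₃.edge,
    h.len_eq ht.swap₁₂.swap₂₃.edge]
  have := h.1 i
  have := h.1 j
  have := h.1 k
  field_simp
  ring

theorem IsPackingMetric.sin_faceAngle (h : IsPackingMetric K d κ) (hd : IsPreMetric K d)
    (ht : IsTriangle K i j k) :
    Real.sin (faceAngle d i j k) =
      2 * κ i * √(packTri κ i j k) / ((κ i + κ j) * (κ i + κ k)) := by
  have hi := h.1 i
  have hj := h.1 j
  have hk := h.1 k
  have hq := packTri_pos h.1 i j k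
  rw [← sq_eq_sq₀ (hd.sin_faceAngle_pos ht).le (by positivity), Real.sin_sq,
    h.cos_faceAngle hd ht, div_pow, mul_pow, Real.sq_sqrt hq.le, packTri]
  field_simp
  ring

/-- The center of a face is its incenter, so its distance to each edge is the inradius. -/
theorem IsPackingMetric.triHeight (h : IsPackingMetric K d κ) (hd : IsPreMetric K d)
    (ht : IsTriangle K i j k) : triHeight d i j k = (√(packTri κ i j k))⁻¹ := by
  have hi := h.1 i
  have hj := h.1 j
  have hk := h.1 k
  have hq := Real.sqrt_pos.2 (packTri_pos h.1 i j k)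
  rw [PiecewiseFlat.triHeight, h.sin_faceAngle hd ht, h.cos_faceAngle hd ht, h.2 i k ht.swap₂₃.edge,
    h.2 i j ht.edge]
  field_simp
  ring

theorem IsPackingMetric.cos_dihedralAngle (h : IsPackingMetric K d κ) (hd : IsPreMetric K d)
    (ht : IsTetrahedron K i j k l) :
    Real.cos (dihedralAngle d i j k l) =
      (2 * κ i * κ j + (κ i + κ j) * (κ k + κ l) - (κ i + κ j) ^ 2) /
        (2 * √(packTri κ i j k) * √(packTri κ i j l)) := by
  have hi := h.1 i
  have hj := h.1 j
  have hk := h.1 k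
  have hl := h.1 l
  have hq := Real.sqrt_pos.2 (packTri_pos h.1 i j k)
  have hq' := Real.sqrt_pos.2 (packTri_pos h.1 i j l)
  rw [hd.cos_dihedralAngle ht, dihedralCos, h.sin_faceAngle hd ht.triangle,
    h.sin_faceAngle hd ht.swap₃₄.triangle, h.cos_faceAngle hd ht.triangle,
    h.cos_faceAngle hd ht.swap₃₄.triangle, h.cos_faceAngle hd ht.rotate.triangle]
  field_simp
  ring

/-- With `N` the numerator of the cosine of the dihedral angle and `T`, `T'` the two values of
`packTri`, `4 T T' - N²` equals `(κ i + κ j)²` times `packDelta`, so `cos² < 1` gives the sign. -/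
theorem IsPackingMetric.packDelta_pos (h : IsPackingMetric K d κ) (hd : IsPreMetric K d)
    (ht : IsTetrahedron K i j k l) : 0 < packDelta (κ i) (κ j) (κ k) (κ l) := by
  have hi := h.1 i
  have hj := h.1 j
  have hq := packTri_pos h.1 i j k
  have hq' := packTri_pos h.1 i j l
  have hlt := hd.dihedralCos_sq_lt ht
  rw [← hd.cos_dihedralAngle ht, h.cos_dihedralAngle hd ht, div_pow,
    div_lt_one (by positivity), mul_pow, mul_pow, Real.sq_sqrt hq.le, Real.sq_sqrt hq'.le] at hlt
  have hs : 0 < (κ i + κ j) ^ 2 := by positivity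
  refine pos_of_mul_pos_right (lt_of_lt_of_eq (sub_pos.2 hlt) ?_) hs.le
  unfold packTri packDelta
  ring

theorem IsPackingMetric.sin_dihedralAngle (h : IsPackingMetric K d κ) (hd : IsPreMetric K d)
    (ht : IsTetrahedron K i j k l) :
    Real.sin (dihedralAngle d i j k l) =
      √(packDelta (κ i) (κ j) (κ k) (κ l)) * (κ i + κ j) /
        (2 * √(packTri κ i j k) * √(packTri κ i j l)) := by
  have hi := h.1 i
  have hj := h.1 j
  have hq := packTri_pos h.1 i j k
  have hq' := packTri_pos h.1 i j l
  have hΔ := h.packDelta_pos hd ht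
  rw [← sq_eq_sq₀ (hd.sin_dihedralAngle_pos ht).le (by positivity), Real.sin_sq,
    h.cos_dihedralAngle hd ht, div_pow, div_pow, mul_pow, mul_pow, mul_pow, Real.sq_sqrt hq.le,
    Real.sq_sqrt hq'.le, Real.sq_sqrt hΔ.le]
  rw [eq_div_iff (by positivity), sub_mul, div_mul_cancel₀ _ (by positivity)]
  unfold packTri packDelta
  ring

theorem IsPackingMetric.tetHeight (h : IsPackingMetric K d κ) (hd : IsPreMetric K d)
    (ht : IsTetrahedron K i j k l) :
    tetHeight d i j k l = (κ i + κ j + κ k - κ l) /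
      (√(packDelta (κ i) (κ j) (κ k) (κ l)) * √(packTri κ i j k)) := by
  have hi := h.1 i
  have hj := h.1 j
  have hq := Real.sqrt_pos.2 (packTri_pos h.1 i j k)
  have hq' := Real.sqrt_pos.2 (packTri_pos h.1 i j l)
  have hΔ := Real.sqrt_pos.2 (h.packDelta_pos hd ht)
  have e := Real.sq_sqrt (packTri_pos h.1 i j k).le
  rw [PiecewiseFlat.tetHeight, h.triHeight hd ht.triangle, h.triHeight hd ht.swap₃₄.triangle,
    h.cos_dihedralAngle hd ht, h.sin_dihedralAngle hd ht]
  field_simp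
  rw [e, packTri]
  ring

/-- The dual area of an edge of a sphere packing metric. -/
theorem IsPackingMetric.dualArea_div_len (h : IsPackingMetric K d κ) (hd : IsPreMetric K d)
    (ht : IsTetrahedron K i j k l) :
    dualArea d i j k l / len d i j =
      packWeight (κ i) (κ j) (κ k) (κ l) / (2 * √(packDelta (κ i) (κ j) (κ k) (κ l))) := by
  have hi := h.1 i
  have hj := h.1 j
  have hq := Real.sqrt_pos.2 (packTri_pos h.1 i j k)
  have hq' := Real.sqrt_pos.2 (packTri_pos h.1 i j l)
  have hΔ := Real.sqrt_pos.2 (h.packDelta_pos hd ht)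
  have e := Real.sq_sqrt (packTri_pos h.1 i j k).le
  have e' := Real.sq_sqrt (packTri_pos h.1 i j l).le
  rw [dualArea, h.triHeight hd ht.triangle, h.triHeight hd ht.swap₃₄.triangle,
    h.tetHeight hd ht, h.tetHeight hd ht.swap₃₄, h.len_eq ht.edge,
    packDelta_swap₃₄ (κ i) (κ j) (κ k) (κ l), packWeight, packNum]
  change _ = _ / (packTri κ i j k * packTri κ i j l) / _
  have hp := packTri_pos h.1 i j k
  have hp' := packTri_pos h.1 i j l
  field_simp
  rw [e, e']
  unfold packTri
  ring

theorem IsSpherePacking.exists_isPackingMetric (h : IsSpherePacking K d) :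
    ∃ κ, IsPackingMetric K d κ := by
  obtain ⟨f, hf⟩ := h
  exact ⟨fun i => Real.exp (-f i), fun i => Real.exp_pos _, fun i j e => by
    simp [hf i j e, Real.exp_neg]⟩

end PackingMetric

/-! ### The kernel of the Laplacian -/

section Kernel

variable {V : Type*} [Fintype V] [DecidableEq V] {K : AbstractSimplicialComplex V}
  {d : V → V → ℝ} {x : V → ℝ}

theorem single_mem_realization (i : V) : Pi.single i (1 : ℝ) ∈ realization K := by
  refine ⟨fun j => ?_, by simp, {i}, K.singleton_mem i, fun j hj => ?_⟩
  · by_cases h : j = i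
    · subst h; simp
    · simp [h]
  · have : j ≠ i := by simpa using hj
    simp [this]

/-- The `1`-skeleton of a triangulation of a connected space is connected. -/
theorem IsTriangulation.iff_of_edge {M : Type*} [TopologicalSpace M] [ConnectedSpace M]
    (hT : IsTriangulation K M) {P : V → Prop} (hP : ∀ i j, IsEdge K i j → (P i → P j)) (i j : V)
    (hi : P i) : P j := by
  obtain ⟨e⟩ := hT
  have : ConnectedSpace (realization K) := e.symm.surjective.connectedSpace e.symm.continuous
  have hR : IsPreconnected (realization K) :=
    (isConnected_iff_connectedSpace.2 this).isPreconnected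
  by_contra hj
  -- The open sets for `P` and for `¬ P` cover the realization and both meet it. A common point lies
  -- in a simplex with a vertex of each kind, and these two vertices span an edge.
  have hopen : ∀ Q : V → Prop, IsOpen {p : V → ℝ | ∃ v, Q v ∧ 0 < p v} := fun Q => by
    have : {p : V → ℝ | ∃ v, Q v ∧ 0 < p v} = ⋃ v, ⋃ _ : Q v, {p | 0 < p v} := by
      ext p; simp
    rw [this]
    exact isOpen_iUnion fun v => isOpen_iUnion fun _ =>
      isOpen_lt continuous_const (continuous_apply v)
  obtain ⟨p, ⟨-, -, s, hs, hps⟩, ⟨v, hv, pv⟩, w, hw, pw⟩ :=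
    hR _ _ (hopen P) (hopen fun v => ¬ P v) (fun p hp => by
      obtain ⟨v, -, hv⟩ := Finset.exists_lt_of_sum_lt (s := Finset.univ) (f := fun _ => (0 : ℝ))
        (g := p) (by rw [hp.2.1]; simp)
      by_cases h : P v
      · exact Or.inl ⟨v, h, hv⟩
      · exact Or.inr ⟨v, h, hv⟩)
      ⟨_, single_mem_realization i, i, hi, by simp⟩ ⟨_, single_mem_realization j, j, hj, by simp⟩
  have hvs : v ∈ s := by by_contra h; exact pv.ne' (hps v h)
  have hws : w ∈ s := by by_contra h; exact pw.ne' (hps w h)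
  refine hw (hP v w ⟨fun h => hw (h ▸ hv), face_of_subset hs ?_ (by simp)⟩ hv)
  intro u hu
  rcases Finset.mem_insert.1 hu with rfl | hu
  · exact hvs
  · rw [Finset.mem_singleton.1 hu]; exact hws

/-- Maximum principle: at a maximum of `x` all terms of the Laplacian are nonpositive, so each
vanishes and the maximum spreads along edges. -/
theorem eq_of_dualLaplacian_eq_zero_of_dualLength_pos {M : Type*} [TopologicalSpace M]
    [ConnectedSpace M] (hT : IsTriangulation K M) (hd : IsPreMetric K d)
    (hpos : ∀ i j, IsEdge K i j → 0 < dualLength K d i j)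
    (hx : ∀ i, dualLaplacian K d x i = 0) (i j : V) : x i = x j := by
  classical
  obtain ⟨m, -, hm⟩ := Finset.exists_max_image Finset.univ x ⟨i, Finset.mem_univ i⟩
  have key : ∀ a, x a = x m := fun a =>
    hT.iff_of_edge (P := fun v => x v = x m) (fun v w hvw hv => by
      have h0 := hx v
      unfold dualLaplacian at h0
      have hle : ∀ u ∈ Finset.univ, (if IsEdge K v u then
          2 * dualLength K d v u / len d v u * (x u - x v) else 0) ≤ 0 := fun u _ => by
        split_ifs with h
        · have := hpos v u h
          have := hd.len_pos h
          exact mul_nonpos_of_nonneg_of_nonpos (by positivity)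
            (by linarith [hm u (Finset.mem_univ u)])
        · exact le_rfl
      have hw := (Finset.sum_eq_zero_iff_of_nonpos hle).1 h0 w (Finset.mem_univ w)
      rw [if_pos hvw] at hw
      have h1 := hpos v w hvw
      have h2 := hd.len_pos hvw
      have := (mul_eq_zero.1 hw).resolve_left (by positivity)
      linarith) m a rfl
  rw [key i, key j]

/-- Otherwise the deficit would be `2π`. Ricci flatness thus puts every edge in a tetrahedron, with
no appeal to the manifold structure. -/
theorem exists_isTetrahedron_of_deficit_eq_zero {i j : V} (h : deficit K d i j = 0) :
    ∃ k l, IsTetrahedron K i j k l := by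
  classical
  by_contra! hc
  have := Real.pi_pos
  simp [deficit, sumTetrahedra, hc] at h

omit [DecidableEq V] in
-- The twelve terms correspond to the directed edges of a tetrahedron. Each arises by permuting
-- coordinates, hence has the same total sum.
theorem sum_eq_sum_of_symmetrize {F G : V × V × V × V → ℝ}
    (h : ∀ i j k l, F (i, j, k, l) + F (j, i, k, l) + F (i, k, j, l) + F (k, i, j, l) +
      F (i, l, j, k) + F (l, i, j, k) + F (j, k, i, l) + F (k, j, i, l) + F (j, l, i, k) +
      F (l, j, i, k) + F (k, l, i, j) + F (l, k, i, j) = G (i, j, k, l)) :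
    12 * ∑ p, F p = ∑ p, G p := by
  have e1 : ∑ p : V × V × V × V, F (p.2.1, p.1, p.2.2.1, p.2.2.2) = ∑ p, F p :=
    Equiv.sum_comp (⟨fun p => (p.2.1, p.1, p.2.2.1, p.2.2.2),
      fun p => (p.2.1, p.1, p.2.2.1, p.2.2.2), fun _ => rfl, fun _ => rfl⟩ :
        V × V × V × V ≃ V × V × V × V) F
  have e2 : ∑ p : V × V × V × V, F (p.1, p.2.2.1, p.2.1, p.2.2.2) = ∑ p, F p :=
    Equiv.sum_comp (⟨fun p => (p.1, p.2.2.1, p.2.1, p.2.2.2),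
      fun p => (p.1, p.2.2.1, p.2.1, p.2.2.2), fun _ => rfl, fun _ => rfl⟩ :
        V × V × V × V ≃ V × V × V × V) F
  have e3 : ∑ p : V × V × V × V, F (p.2.2.1, p.1, p.2.1, p.2.2.2) = ∑ p, F p :=
    Equiv.sum_comp (⟨fun p => (p.2.2.1, p.1, p.2.1, p.2.2.2),
      fun p => (p.2.1, p.2.2.1, p.1, p.2.2.2), fun _ => rfl, fun _ => rfl⟩ :
        V × V × V × V ≃ V × V × V × V) F
  have e4 : ∑ p : V × V × V × V, F (p.1, p.2.2.2, p.2.1, p.2.2.1) = ∑ p, F p :=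
    Equiv.sum_comp (⟨fun p => (p.1, p.2.2.2, p.2.1, p.2.2.1),
      fun p => (p.1, p.2.2.1, p.2.2.2, p.2.1), fun _ => rfl, fun _ => rfl⟩ :
        V × V × V × V ≃ V × V × V × V) F
  have e5 : ∑ p : V × V × V × V, F (p.2.2.2, p.1, p.2.1, p.2.2.1) = ∑ p, F p :=
    Equiv.sum_comp (⟨fun p => (p.2.2.2, p.1, p.2.1, p.2.2.1),
      fun p => (p.2.1, p.2.2.1, p.2.2.2, p.1), fun _ => rfl, fun _ => rfl⟩ :
        V × V × V × V ≃ V × V × V × V) F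
  have e6 : ∑ p : V × V × V × V, F (p.2.1, p.2.2.1, p.1, p.2.2.2) = ∑ p, F p :=
    Equiv.sum_comp (⟨fun p => (p.2.1, p.2.2.1, p.1, p.2.2.2),
      fun p => (p.2.2.1, p.1, p.2.1, p.2.2.2), fun _ => rfl, fun _ => rfl⟩ :
        V × V × V × V ≃ V × V × V × V) F
  have e7 : ∑ p : V × V × V × V, F (p.2.2.1, p.2.1, p.1, p.2.2.2) = ∑ p, F p :=
    Equiv.sum_comp (⟨fun p => (p.2.2.1, p.2.1, p.1, p.2.2.2),
      fun p => (p.2.2.1, p.2.1, p.1, p.2.2.2), fun _ => rfl, fun _ => rfl⟩ :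
        V × V × V × V ≃ V × V × V × V) F
  have e8 : ∑ p : V × V × V × V, F (p.2.1, p.2.2.2, p.1, p.2.2.1) = ∑ p, F p :=
    Equiv.sum_comp (⟨fun p => (p.2.1, p.2.2.2, p.1, p.2.2.1),
      fun p => (p.2.2.1, p.1, p.2.2.2, p.2.1), fun _ => rfl, fun _ => rfl⟩ :
        V × V × V × V ≃ V × V × V × V) F
  have e9 : ∑ p : V × V × V × V, F (p.2.2.2, p.2.1, p.1, p.2.2.1) = ∑ p, F p :=
    Equiv.sum_comp (⟨fun p => (p.2.2.2, p.2.1, p.1, p.2.2.1),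
      fun p => (p.2.2.1, p.2.1, p.2.2.2, p.1), fun _ => rfl, fun _ => rfl⟩ :
        V × V × V × V ≃ V × V × V × V) F
  have e10 : ∑ p : V × V × V × V, F (p.2.2.1, p.2.2.2, p.1, p.2.1) = ∑ p, F p :=
    Equiv.sum_comp (⟨fun p => (p.2.2.1, p.2.2.2, p.1, p.2.1),
      fun p => (p.2.2.1, p.2.2.2, p.1, p.2.1), fun _ => rfl, fun _ => rfl⟩ :
        V × V × V × V ≃ V × V × V × V) F
  have e11 : ∑ p : V × V × V × V, F (p.2.2.2, p.2.2.1, p.1, p.2.1) = ∑ p, F p :=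
    Equiv.sum_comp (⟨fun p => (p.2.2.2, p.2.2.1, p.1, p.2.1),
      fun p => (p.2.2.1, p.2.2.2, p.2.1, p.1), fun _ => rfl, fun _ => rfl⟩ :
        V × V × V × V ≃ V × V × V × V) F
  rw [← Finset.sum_congr rfl fun (p : V × V × V × V) _ => h p.1 p.2.1 p.2.2.1 p.2.2.2]
  simp only [Finset.sum_add_distrib, Prod.mk.eta, e1, e2, e3, e4, e5, e6, e7, e8, e9, e10, e11]
  ring

/-- Pairing the Laplacian with `x` gives a negative multiple of a sum of nonnegative forms over
tetrahedra. If it vanishes, each form does, so `x` is constant on each tetrahedron. -/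
theorem eq_of_dualLaplacian_eq_zero_of_isPackingMetric {M : Type*} [TopologicalSpace M]
    [ConnectedSpace M] (hT : IsTriangulation K M) (hd : IsPreMetric K d) (hflat : IsRicciFlat K d)
    {κ : V → ℝ} (hκ : IsPackingMetric K d κ)
    (hx : ∀ i, dualLaplacian K d x i = 0) (i j : V) : x i = x j := by
  classical
  set c : V → V → V → V → ℝ := fun i j k l => 2 * √(packDelta (κ i) (κ j) (κ k) (κ l)) with hc
  set F : V × V × V × V → ℝ := fun p => if IsTetrahedron K p.1 p.2.1 p.2.2.1 p.2.2.2 then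
    dualArea d p.1 p.2.1 p.2.2.1 p.2.2.2 / len d p.1 p.2.1 * (x p.2.1 - x p.1) * x p.1 else 0
    with hF
  set G : V × V × V × V → ℝ := fun p => if IsTetrahedron K p.1 p.2.1 p.2.2.1 p.2.2.2 then
    packForm (κ p.1) (κ p.2.1) (κ p.2.2.1) (κ p.2.2.2) (x p.1) (x p.2.1) (x p.2.2.1) (x p.2.2.2) /
      c p.1 p.2.1 p.2.2.1 p.2.2.2 else 0 with hG
  have hsum : ∑ p, F p = 0 := by
    have : ∀ i, dualLaplacian K d x i * x i = ∑ j, ∑ k, ∑ l, F (i, j, k, l) := fun i => by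
      rw [dualLaplacian_eq_sum_tetrahedra, Finset.sum_mul]
      refine Finset.sum_congr rfl fun j _ => ?_
      rw [Finset.sum_mul]
      refine Finset.sum_congr rfl fun k _ => ?_
      rw [Finset.sum_mul]
      refine Finset.sum_congr rfl fun l _ => ?_
      rw [ite_mul, zero_mul]
    simp only [Fintype.sum_prod_type]
    rw [← Finset.sum_congr rfl fun i _ => this i]
    simp [hx]
  -- The two directions of an edge together contribute minus its weight times the squared difference
  -- of `x`. The denominator `c` is common to all edges, as `packDelta` is symmetric.
  have hFG : ∀ i j k l, F (i, j, k, l) + F (j, i, k, l) + F (i, k, j, l) + F (k, i, j, l) +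
      F (i, l, j, k) + F (l, i, j, k) + F (j, k, i, l) + F (k, j, i, l) + F (j, l, i, k) +
      F (l, j, i, k) + F (k, l, i, j) + F (l, k, i, j) = (fun p => -G p) (i, j, k, l) :=
      fun i j k l => by
    simp only [hF, hG]
    by_cases h : IsTetrahedron K i j k l
    · have h2 := h.swap₁₂
      have h3 := h.swap₂₃
      have h4 := h3.swap₁₂
      have h5 := h.swap₃₄.swap₂₃
      have h6 := h5.swap₁₂
      have h7 := h2.swap₂₃
      have h8 := h7.swap₁₂
      have h9 := h2.swap₃₄.swap₂₃
      have h10 := h9.swap₁₂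
      have h11 := h4.swap₃₄.swap₂₃
      have h12 := h11.swap₁₂
      simp only [if_pos h, if_pos h2, if_pos h3, if_pos h4, if_pos h5, if_pos h6, if_pos h7,
        if_pos h8, if_pos h9, if_pos h10, if_pos h11, if_pos h12]
      have hΔ : ∀ {a b m n : V}, IsTetrahedron K a b m n → packDelta (κ a) (κ b) (κ m) (κ n) =
          packDelta (κ i) (κ j) (κ k) (κ l) → dualArea d a b m n / len d a b =
          packWeight (κ a) (κ b) (κ m) (κ n) / c i j k l := fun ht he => by
        rw [hκ.dualArea_div_len hd ht, he]
      rw [hΔ h rfl, hΔ h2 (by unfold packDelta; ring), hΔ h3 (by unfold packDelta; ring),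
        hΔ h4 (by unfold packDelta; ring), hΔ h5 (by unfold packDelta; ring),
        hΔ h6 (by unfold packDelta; ring), hΔ h7 (by unfold packDelta; ring),
        hΔ h8 (by unfold packDelta; ring), hΔ h9 (by unfold packDelta; ring),
        hΔ h10 (by unfold packDelta; ring), hΔ h11 (by unfold packDelta; ring),
        hΔ h12 (by unfold packDelta; ring), packWeight_swap₁₂ (κ i) (κ j),
        packWeight_swap₁₂ (κ i) (κ k), packWeight_swap₁₂ (κ i) (κ l),
        packWeight_swap₁₂ (κ j) (κ k), packWeight_swap₁₂ (κ j) (κ l),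
        packWeight_swap₁₂ (κ k) (κ l)]
      unfold packForm
      ring
    · have hn : ∀ {a b m n : V}, (IsTetrahedron K a b m n → IsTetrahedron K i j k l) →
          ¬ IsTetrahedron K a b m n := fun hi hh => h (hi hh)
      rw [if_neg h, if_neg (hn fun t => t.swap₁₂), if_neg (hn fun t => t.swap₂₃),
        if_neg (hn fun t => t.swap₁₂.swap₂₃), if_neg (hn fun t => t.swap₂₃.swap₃₄),
        if_neg (hn fun t => t.swap₁₂.swap₂₃.swap₃₄), if_neg (hn fun t => t.swap₂₃.swap₁₂),
        if_neg (hn fun t => t.swap₁₂.swap₂₃.swap₁₂),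
        if_neg (hn fun t => t.swap₂₃.swap₃₄.swap₁₂),
        if_neg (hn fun t => t.swap₁₂.swap₂₃.swap₃₄.swap₁₂),
        if_neg (hn fun t => t.swap₂₃.swap₃₄.swap₁₂.swap₂₃),
        if_neg (hn fun t => t.swap₁₂.swap₂₃.swap₃₄.swap₁₂.swap₂₃)]
      simp [h]
  have hGsum : ∑ p, G p = 0 := by
    have := sum_eq_sum_of_symmetrize (F := F) (G := fun p => -G p) hFG
    rw [hsum, Finset.sum_neg_distrib] at this
    linarith
  have hGnonneg : ∀ p ∈ Finset.univ, 0 ≤ G p := fun p _ => by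
    simp only [hG]
    split_ifs with h
    · exact div_nonneg (packForm_nonneg (hκ.1 _) (hκ.1 _) (hκ.1 _) (hκ.1 _)
        (hκ.packDelta_pos hd h) _ _ _ _).1 (by positivity)
    · exact le_rfl
  have hedge : ∀ a b, IsEdge K a b → x a = x b := fun a b hab => by
    obtain ⟨k, l, ht⟩ := exists_isTetrahedron_of_deficit_eq_zero (deficit_eq_zero hd hflat hab)
    have h0 := (Finset.sum_eq_zero_iff_of_nonneg hGnonneg).1 hGsum (a, b, k, l) (Finset.mem_univ _)
    simp only [hG, if_pos ht] at h0
    have hΔ := hκ.packDelta_pos hd ht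
    have hcpos : c a b k l ≠ 0 := by
      have := Real.sqrt_pos.2 hΔ
      simp only [hc]
      positivity
    exact ((packForm_nonneg (hκ.1 _) (hκ.1 _) (hκ.1 _) (hκ.1 _) hΔ _ _ _ _).2
      ((div_eq_zero_iff.1 h0).resolve_right hcpos)).1
  exact (hT.iff_of_edge (P := fun v => x v = x i)
    (fun a b hab ha => (hedge a b hab).symm.trans ha) i j rfl).symm

end Kernel

/-! ### Scaling -/

section Scaling

variable {V : Type*} [Fintype V] [DecidableEq V] {K : AbstractSimplicialComplex V}
  {d d' : V → V → ℝ} {c : ℝ} {i j k l : V}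

/-- The restriction of `d'` to the directed edges is `c` times that of `d`. -/
def IsScaling (K : AbstractSimplicialComplex V) (c : ℝ) (d d' : V → V → ℝ) : Prop :=
  0 < c ∧ ∀ i j, IsEdge K i j → d' i j = c * d i j

omit [Fintype V] in
theorem IsScaling.len (h : IsScaling K c d d') (e : IsEdge K i j) : len d' i j = c * len d i j := by
  unfold PiecewiseFlat.len
  rw [h.2 i j e, h.2 j i e.symm, mul_add]

omit [Fintype V] in
theorem IsScaling.faceAngle (h : IsScaling K c d d') (ht : IsTriangle K i j k) :
    faceAngle d' i j k = faceAngle d i j k := by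
  unfold PiecewiseFlat.faceAngle
  rw [h.len ht.edge, h.len ht.swap₂₃.edge, h.len ht.swap₁₂.swap₂₃.edge]
  congr 1
  have := h.1.ne'
  rw [← mul_div_mul_left (_ - _) (2 * PiecewiseFlat.len d i j * PiecewiseFlat.len d i k)
    (pow_ne_zero 2 this)]
  ring

omit [Fintype V] in
theorem IsScaling.dihedralAngle (h : IsScaling K c d d') (ht : IsTetrahedron K i j k l) :
    dihedralAngle d' i j k l = dihedralAngle d i j k l := by
  unfold PiecewiseFlat.dihedralAngle
  rw [h.faceAngle ht.triangle, h.faceAngle ht.swap₃₄.triangle, h.faceAngle ht.rotate.triangle]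

omit [Fintype V] in
theorem IsScaling.triHeight (h : IsScaling K c d d') (ht : IsTriangle K i j k) :
    triHeight d' i j k = c * triHeight d i j k := by
  unfold PiecewiseFlat.triHeight
  rw [h.faceAngle ht, h.2 _ _ ht.edge, h.2 _ _ ht.swap₂₃.edge]
  ring

omit [Fintype V] in
theorem IsScaling.tetHeight (h : IsScaling K c d d') (ht : IsTetrahedron K i j k l) :
    tetHeight d' i j k l = c * tetHeight d i j k l := by
  unfold PiecewiseFlat.tetHeight
  rw [h.dihedralAngle ht, h.triHeight ht.triangle, h.triHeight ht.swap₃₄.triangle]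
  ring

omit [Fintype V] in
theorem IsScaling.dualArea (h : IsScaling K c d d') (ht : IsTetrahedron K i j k l) :
    dualArea d' i j k l = c ^ 2 * dualArea d i j k l := by
  unfold PiecewiseFlat.dualArea
  rw [h.triHeight ht.triangle, h.triHeight ht.swap₃₄.triangle, h.tetHeight ht,
    h.tetHeight ht.swap₃₄]
  ring

theorem IsScaling.dualLength (h : IsScaling K c d d') :
    dualLength K d' i j = c ^ 2 * dualLength K d i j := by
  classical
  unfold PiecewiseFlat.dualLength sumTetrahedra
  rw [mul_left_comm]
  congr 1
  rw [Finset.mul_sum]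
  refine Finset.sum_congr rfl fun k _ => ?_
  rw [Finset.mul_sum]
  refine Finset.sum_congr rfl fun l _ => ?_
  split_ifs with ht
  · exact h.dualArea ht
  · rw [mul_zero]

theorem IsScaling.deficit (h : IsScaling K c d d') : deficit K d' i j = deficit K d i j := by
  classical
  unfold PiecewiseFlat.deficit sumTetrahedra
  congr 2
  refine Finset.sum_congr rfl fun k _ => Finset.sum_congr rfl fun l _ => ?_
  split_ifs with ht
  · exact h.dihedralAngle ht
  · rfl

theorem IsScaling.scalarCurvature (h : IsScaling K c d d') (i : V) :
    scalarCurvature K d' i = c * scalarCurvature K d i := by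
  classical
  unfold PiecewiseFlat.scalarCurvature
  rw [Finset.mul_sum]
  refine Finset.sum_congr rfl fun j _ => ?_
  split_ifs with e
  · rw [h.deficit, h.2 i j e]; ring
  · rw [mul_zero]

theorem IsScaling.isRicciFlat (h : IsScaling K c d d') (hd : IsRicciFlat K d) :
    IsRicciFlat K d' := fun i j e => by
  have := hd i j e
  unfold edgeCurvature at *
  rw [h.deficit, h.len e, mul_left_comm, this, mul_zero]

omit [Fintype V] in
theorem IsScaling.isSpherePacking (h : IsScaling K c d d') (hd : IsSpherePacking K d) :
    IsSpherePacking K d' := by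
  obtain ⟨f, hf⟩ := hd
  exact ⟨fun i => Real.log c + f i, fun i j e => by
    rw [h.2 i j e, hf i j e, Real.exp_add, Real.exp_log h.1]⟩

theorem scalarCurvature_eq_zero (hd : IsPreMetric K d) (hflat : IsRicciFlat K d) (i : V) :
    scalarCurvature K d i = 0 := by
  classical
  refine Finset.sum_eq_zero fun j _ => ?_
  split_ifs with e
  · rw [deficit_eq_zero hd hflat e, zero_mul]
  · rfl

end Scaling

/-! ### Conformal structures -/

namespace ConformalStructure

open Filter Topology

variable {V : Type*} [Fintype V] [DecidableEq V] {K : AbstractSimplicialComplex V}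
  (C : ConformalStructure K) {g : V → ℝ} {i j k l : V}

theorem contDiffAt_metric (hg : g ∈ C.U) (e : IsEdge K i j) :
    ContDiffAt ℝ ∞ (fun h => C.metric h i j) g :=
  (C.smooth i j e).contDiffAt (C.isOpen_U.mem_nhds hg)

theorem contDiffAt_len (hg : g ∈ C.U) (e : IsEdge K i j) :
    ContDiffAt ℝ ∞ (fun h => len (C.metric h) i j) g :=
  (C.contDiffAt_metric hg e).add (C.contDiffAt_metric hg e.symm)

theorem contDiffAt_faceAngle (hg : g ∈ C.U) (ht : IsTriangle K i j k) :
    ContDiffAt ℝ ∞ (fun h => faceAngle (C.metric h) i j k) g := by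
  have hd := (C.metric_mem g hg).1
  have habs := abs_lt.1 ((sq_lt_one_iff_abs_lt_one _).1 (hd.faceCos_sq_lt ht))
  have h1 := C.contDiffAt_len hg ht.edge
  have h2 := C.contDiffAt_len hg ht.swap₂₃.edge
  have h3 := C.contDiffAt_len hg ht.swap₁₂.swap₂₃.edge
  have p1 := hd.len_pos ht.edge
  have p2 := hd.len_pos ht.swap₂₃.edge
  have hq : ContDiffAt ℝ ∞ (fun h => faceCos (C.metric h) i j k) g :=
    (((h1.pow 2).add (h2.pow 2)).sub (h3.pow 2)).div ((contDiffAt_const.mul h1).mul h2)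
      (by positivity)
  exact (Real.contDiffAt_arccos habs.1.ne' habs.2.ne).comp g hq

theorem contDiffAt_dihedralAngle (hg : g ∈ C.U) (ht : IsTetrahedron K i j k l) :
    ContDiffAt ℝ ∞ (fun h => dihedralAngle (C.metric h) i j k l) g := by
  have hd := (C.metric_mem g hg).1
  have habs := abs_lt.1 ((sq_lt_one_iff_abs_lt_one _).1 (hd.dihedralCos_sq_lt ht))
  have h1 := C.contDiffAt_faceAngle hg ht.triangle
  have h2 := C.contDiffAt_faceAngle hg ht.swap₃₄.triangle
  have h3 := C.contDiffAt_faceAngle hg ht.rotate.triangle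
  have p1 := hd.sin_faceAngle_pos ht.triangle
  have p2 := hd.sin_faceAngle_pos ht.swap₃₄.triangle
  have hq : ContDiffAt ℝ ∞ (fun h => dihedralCos (C.metric h) i j k l) g :=
    (h3.cos.sub (h1.cos.mul h2.cos)).div (h1.sin.mul h2.sin) (by positivity)
  exact (Real.contDiffAt_arccos habs.1.ne' habs.2.ne).comp g hq

theorem contDiffAt_scalarCurvature (hg : g ∈ C.U) (i : V) :
    ContDiffAt ℝ ∞ (fun h => scalarCurvature K (C.metric h) i) g := by
  classical
  unfold scalarCurvature deficit sumTetrahedra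
  refine ContDiffAt.sum fun j _ => ?_
  split_ifs with e
  · refine ContDiffAt.mul (contDiffAt_const.sub (contDiffAt_const.mul ?_))
      (C.contDiffAt_metric hg e)
    refine ContDiffAt.sum fun k _ => ContDiffAt.sum fun l _ => ?_
    split_ifs with ht
    · exact C.contDiffAt_dihedralAngle hg ht
    · exact contDiffAt_const
  · exact contDiffAt_const

/-- Smoothness makes the derivative linear in the direction, so the partial derivatives determine
it; those at vertices other than `i`, `j` vanish. -/
theorem hasDerivAt_len (hg : g ∈ C.U) (x : V → ℝ) (e : IsEdge K i j) :
    HasDerivAt (fun s : ℝ => len (C.metric (g + s • x)) i j)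
      (C.metric g i j * x i + C.metric g j i * x j) 0 := by
  have hL := ((C.contDiffAt_len hg e).differentiableAt (by simp)).hasFDerivAt
  set L := fderiv ℝ (fun h => len (C.metric h) i j) g
  have hi : L (Pi.single i 1) = C.metric g i j :=
    (hL.hasLineDerivAt _).unique (C.partial_len g hg i j e)
  have hj : L (Pi.single j 1) = C.metric g j i := by
    refine (hL.hasLineDerivAt _).unique ?_
    simp only [len_comm _ i j]
    exact C.partial_len g hg j i e.symm
  have hk : ∀ k, k ≠ i ∧ k ≠ j → L (Pi.single k 1) = 0 := fun k hk => by
    refine (hL.hasLineDerivAt _).unique ?_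
    have := (C.partial_metric g hg i j e k hk.1 hk.2).add
      (C.partial_metric g hg j i e.symm k hk.2 hk.1)
    rw [add_zero] at this
    exact this
  have hx : L x = C.metric g i j * x i + C.metric g j i * x j := by
    conv_lhs => rw [← Finset.univ_sum_single x, map_sum]
    have hs : ∀ k, L (Pi.single k (x k)) = x k * L (Pi.single k 1) := fun k => by
      rw [← smul_eq_mul, ← map_smul, ← Pi.single_smul, smul_eq_mul, mul_one]
    simp only [hs]
    rw [Fintype.sum_eq_add i j e.1 fun k h => by rw [hk k h, mul_zero], hi, hj]
    ring
  have := hL.hasLineDerivAt x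
  rw [hx] at this
  exact this

theorem isConformalCurve (hg : g ∈ C.U) (x : V → ℝ) :
    IsConformalCurve K (fun s : ℝ => C.metric (g + s • x)) x := fun i j e => by
  have := C.hasDerivAt_len hg x e
  simpa only [zero_smul, add_zero] using this

theorem hasLineDerivAt_scalarCurvature (hg : g ∈ C.U) (hflat : IsRicciFlat K (C.metric g))
    (x : V → ℝ) (i : V) :
    HasLineDerivAt ℝ (fun h => scalarCurvature K (C.metric h) i)
      (-dualLaplacian K (C.metric g) x i) g x := by
  have h0 : C.metric (g + (0 : ℝ) • x) = C.metric g := by rw [zero_smul, add_zero]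
  have := (C.isConformalCurve hg x).hasDerivAt_scalarCurvature (fun i j e => by
    have := ((C.contDiffAt_metric hg e).differentiableAt (by simp)).hasFDerivAt.hasLineDerivAt x
    exact HasDerivAt.differentiableAt this) (by rw [h0]; exact C.metric_mem g hg)
    (by rw [h0]; exact hflat) i
  rw [h0] at this
  exact this

/-- Moving along the constant functions scales the metric. -/
theorem eventually_isScaling (hg : g ∈ C.U) :
    ∀ᶠ s : ℝ in 𝓝 0, g + s • (1 : V → ℝ) ∈ C.U ∧
      IsScaling K (Real.exp s) (C.metric g) (C.metric (g + s • (1 : V → ℝ))) := by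
  obtain ⟨r, hr, hball⟩ := Metric.isOpen_iff.1 C.isOpen_U g hg
  have hmem : ∀ h ∈ Metric.ball g (r / 2), ∀ s ∈ Ioo (-(r / 2)) (r / 2),
      h + s • (1 : V → ℝ) ∈ C.U := fun h hh s hs => by
    refine hball ?_
    rw [Metric.mem_ball, dist_eq_norm] at *
    have h1 : ‖s • (1 : V → ℝ)‖ ≤ |s| := by
      rw [norm_smul, Real.norm_eq_abs]
      refine mul_le_of_le_one_right (abs_nonneg s) ((pi_norm_le_iff_of_nonneg zero_le_one).2 ?_)
      simp
    have h2 : |s| < r / 2 := abs_lt.2 hs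
    calc ‖h + s • (1 : V → ℝ) - g‖ = ‖(h - g) + s • (1 : V → ℝ)‖ := by congr 1; abel
      _ ≤ ‖h - g‖ + ‖s • (1 : V → ℝ)‖ := norm_add_le _ _
      _ < r := by linarith
  -- Along the constant direction the derivative of a length is the length itself, which forces
  -- exponential growth. A whole ball of base points is needed, because the identity is
  -- differentiated in `f_i` below to recover `d_ij`.
  have hlen : ∀ h ∈ Metric.ball g (r / 2), ∀ s ∈ Ioo (-(r / 2)) (r / 2), ∀ i j, IsEdge K i j →
      len (C.metric (h + s • (1 : V → ℝ))) i j = Real.exp s * len (C.metric h) i j := by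
    intro h hh s hs i j e
    have hder : ∀ u ∈ Ioo (-(r / 2)) (r / 2),
        HasDerivAt (fun u : ℝ => Real.exp (-u) * len (C.metric (h + u • (1 : V → ℝ))) i j) 0 u :=
        fun u hu => by
      have h1 := C.hasDerivAt_len (hmem h hh u hu) 1 e
      have h2 : HasDerivAt (fun v : ℝ => len (C.metric (h + v • (1 : V → ℝ))) i j)
          (len (C.metric (h + u • (1 : V → ℝ))) i j) u := by
        have h3 : HasDerivAt (fun v : ℝ => v - u) 1 u := (hasDerivAt_id u).sub_const u
        have h4 := h1.comp_of_eq u h3 (sub_self u).symm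
        simp only [Pi.one_apply, mul_one] at h4
        refine h4.congr_of_eventuallyEq (.of_forall fun v => ?_)
        simp only [Function.comp]
        rw [add_assoc, ← add_smul, add_sub_cancel]
      have h3 : HasDerivAt (fun v : ℝ => Real.exp (-v)) (-Real.exp (-u)) u := by
        simpa using (hasDerivAt_neg u).exp
      refine (h3.mul h2).congr_deriv ?_
      ring
    have hconst := isOpen_Ioo.is_const_of_deriv_eq_zero isPreconnected_Ioo
      (fun u hu => (hder u hu).differentiableAt.differentiableWithinAt)
      (fun u hu => (hder u hu).deriv) hs (show (0 : ℝ) ∈ _ from ⟨by linarith, by linarith⟩)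
    simp only [neg_zero, Real.exp_zero, one_mul, zero_smul, add_zero] at hconst
    rw [← hconst, ← mul_assoc, ← Real.exp_add, add_neg_cancel, Real.exp_zero, one_mul]
  have hgb : g ∈ Metric.ball g (r / 2) := Metric.mem_ball_self (by linarith)
  filter_upwards [Ioo_mem_nhds (show -(r / 2) < 0 by linarith) (show 0 < r / 2 by linarith)]
    with s hs
  refine ⟨hmem g hgb s hs, Real.exp_pos s, fun i j e => ?_⟩
  have h1 := C.partial_len _ (hmem g hgb s hs) i j e
  have h2 := HasDerivAt.const_mul (Real.exp s) (C.partial_len g hg i j e)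
  refine HasDerivAt.unique h1 (h2.congr_of_eventuallyEq ?_)
  have hev : ∀ᶠ u : ℝ in 𝓝 0, g + u • (Pi.single i 1 : V → ℝ) ∈ Metric.ball g (r / 2) := by
    have hc : Continuous fun u : ℝ => g + u • (Pi.single i 1 : V → ℝ) := by fun_prop
    exact hc.continuousAt.preimage_mem_nhds
      (by rw [zero_smul, add_zero]; exact Metric.ball_mem_nhds g (by linarith))
  filter_upwards [hev] with u hu
  rw [← hlen _ hu s hs i j e, add_right_comm]

end ConformalStructure

/-! ### Rigidity -/

section Rigidity

open Filter Topology

/-- A map with injective strict derivative is injective near the point. -/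
theorem _root_.HasStrictFDerivAt.eventually_eq_of_injective {E F : Type*}
    [NormedAddCommGroup E] [NormedSpace ℝ E] [FiniteDimensional ℝ E]
    [NormedAddCommGroup F] [NormedSpace ℝ F] [FiniteDimensional ℝ F]
    {Φ : E → F} {Φ' : E →L[ℝ] F} {a : E} (h : HasStrictFDerivAt Φ Φ' a)
    (hinj : Function.Injective Φ') :
    ∃ N ∈ 𝓝 a, InjOn Φ N := by
  have : CompleteSpace E := FiniteDimensional.complete ℝ E
  -- Composing with a linear left inverse of the derivative gives a map with derivative the
  -- identity, to which the inverse function theorem applies.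
  obtain ⟨G, hG⟩ := LinearMap.exists_leftInverse_of_injective (Φ' : E →ₗ[ℝ] F)
    (LinearMap.ker_eq_bot.2 hinj)
  have hcomp : HasStrictFDerivAt (fun x => G (Φ x))
      ((ContinuousLinearEquiv.refl ℝ E : E ≃L[ℝ] E) : E →L[ℝ] E) a := by
    refine ((LinearMap.toContinuousLinearMap G).hasStrictFDerivAt.comp a h).congr_fderiv ?_
    ext x
    exact LinearMap.congr_fun hG x
  refine ⟨_, hcomp.eventually_left_inverse, fun x hx y hy hxy => ?_⟩
  have hx' : hcomp.localInverse (fun x => G (Φ x)) _ a (G (Φ x)) = x := hx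
  have hy' : hcomp.localInverse (fun x => G (Φ x)) _ a (G (Φ y)) = y := hy
  rw [← hx', ← hy', hxy]

variable {V : Type*} [Fintype V] [DecidableEq V] {K : AbstractSimplicialComplex V}

/-- Near a Ricci flat metric whose Laplacian has only constants in its kernel, the metrics of a
conformal structure with vanishing scalar curvature are scalings. -/
theorem ConformalStructure.eventually_isScaling_of_scalarCurvature_eq_zero [Nonempty V]
    (C : ConformalStructure K) {g : V → ℝ} (hg : g ∈ C.U) (hflat : IsRicciFlat K (C.metric g))
    (hker : ∀ x : V → ℝ, (∀ i, dualLaplacian K (C.metric g) x i = 0) → ∀ i j, x i = x j) :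
    ∀ᶠ h in 𝓝 g, (∀ i, scalarCurvature K (C.metric h) i = 0) →
      ∃ c, IsScaling K c (C.metric g) (C.metric h) := by
  have hK : HasStrictFDerivAt (fun h i => scalarCurvature K (C.metric h) i) _ g :=
    (contDiffAt_pi.2 fun i => C.contDiffAt_scalarCurvature hg i).hasStrictFDerivAt (by simp)
  set L := fderiv ℝ (fun h i => scalarCurvature K (C.metric h) i) g
  have hL : ∀ x i, L x i = -dualLaplacian K (C.metric g) x i := fun x i =>
    ((hasFDerivAt_pi'.1 hK.hasFDerivAt i).hasLineDerivAt x).unique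
      (C.hasLineDerivAt_scalarCurvature hg hflat x i)
  -- The kernel consists of constants, on which the coordinate sum is injective. Adjoining it makes
  -- the derivative injective.
  let S : (V → ℝ) →L[ℝ] ℝ := ∑ i, ContinuousLinearMap.proj i
  have hS : ∀ x, S x = ∑ i, x i := fun x => by simp [S]
  have hcard : (Fintype.card V : ℝ) ≠ 0 := by exact_mod_cast Fintype.card_ne_zero
  have hinj : Function.Injective (L.prod S) := by
    rw [injective_iff_map_eq_zero]
    intro x hx
    have h1 : L x = 0 := congrArg Prod.fst hx
    have h2 : S x = 0 := congrArg Prod.snd hx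
    have hc := hker x fun i => by
      have := congr_fun h1 i
      rw [hL, Pi.zero_apply, neg_eq_zero] at this
      exact this
    funext i
    rw [hS, Finset.sum_congr rfl fun j _ => hc j i, Finset.sum_const, Finset.card_univ,
      nsmul_eq_mul] at h2
    exact (mul_eq_zero.1 h2).resolve_left hcard
  obtain ⟨N, hN, hNinj⟩ := (hK.prodMk S.hasStrictFDerivAt).eventually_eq_of_injective hinj
  -- Chosen so that `g + s h • 1` has the same coordinate sum as `h`. If both have zero scalar
  -- curvature, local injectivity identifies them.
  let s : (V → ℝ) → ℝ := fun h => S (h - g) / Fintype.card V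
  have hs : Continuous s := by fun_prop
  have hs0 : s g = 0 := by simp [s]
  have ht : Tendsto s (𝓝 g) (𝓝 0) := hs0 ▸ hs.tendsto g
  have hy : Tendsto (fun h => g + s h • (1 : V → ℝ)) (𝓝 g) (𝓝 g) := by
    have hc : Continuous fun h => g + s h • (1 : V → ℝ) := by fun_prop
    simpa [hs0] using hc.tendsto g
  filter_upwards [ht.eventually (C.eventually_isScaling hg), hy hN, hN] with h h1 h2 h3 h4
  refine ⟨Real.exp (s h), ?_⟩
  have heq : h = g + s h • (1 : V → ℝ) := hNinj h3 h2 (Prod.ext (funext fun i => ?_) ?_)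
  · have h5 := h1.2
    rwa [← heq] at h5
  · change scalarCurvature K (C.metric h) i = scalarCurvature K (C.metric _) i
    rw [h4, h1.2.scalarCurvature, scalarCurvature_eq_zero (C.metric_mem g hg).1 hflat, mul_zero]
  · change S h = S (g + s h • (1 : V → ℝ))
    have h5 : S (1 : V → ℝ) = Fintype.card V := by simp [hS]
    rw [map_add, map_smul, h5, smul_eq_mul, div_mul_cancel₀ _ hcard, map_sub]
    ring

/-- Scaling multiplies `ℓ*` by `c ^ 2` and shifts the packing function by `log c`, so the local
result is available at every scaling of `d`. -/
theorem isRicciFlat_and_kernel {M : Type*} [TopologicalSpace M] [ConnectedSpace M]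
    (hT : IsTriangulation K M) {d d' : V → V → ℝ} {c : ℝ} (hd' : IsPreMetric K d')
    (hflat : IsRicciFlat K d)
    (h : (∀ i j, IsEdge K i j → 0 < dualLength K d i j) ∨ IsSpherePacking K d)
    (hs : IsScaling K c d d') :
    IsRicciFlat K d' ∧
      ∀ x : V → ℝ, (∀ i, dualLaplacian K d' x i = 0) → ∀ i j, x i = x j := by
  refine ⟨hs.isRicciFlat hflat, fun x hx i j => ?_⟩
  rcases h with h | h
  · refine eq_of_dualLaplacian_eq_zero_of_dualLength_pos hT hd' (fun a b e => ?_) hx i j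
    rw [hs.dualLength]
    exact mul_pos (pow_pos hs.1 2) (h a b e)
  · obtain ⟨κ, hκ⟩ := (hs.isSpherePacking h).exists_isPackingMetric
    exact eq_of_dualLaplacian_eq_zero_of_isPackingMetric hT hd' (hs.isRicciFlat hflat) hκ hx i j

theorem isRigid_of_isRicciFlat {M : Type*} [TopologicalSpace M] [ConnectedSpace M]
    (hT : IsTriangulation K M) {d : V → V → ℝ} (hd : d ∈ met K) (hflat : IsRicciFlat K d)
    (h : (∀ i j, IsEdge K i j → 0 < dualLength K d i j) ∨ IsSpherePacking K d) :
    IsRigid K d := by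
  intro ε f C hε ⟨hf, hfU, hf0⟩ hcurv
  by_cases hE : ∃ a b, IsEdge K a b
  swap
  · push Not at hE
    exact fun t _ => ⟨1, one_pos, fun i j e => (hE i j e).elim⟩
  obtain ⟨a, b, hab⟩ := hE
  have : Nonempty V := ⟨a⟩
  have hcont : ∀ t ∈ Ioo (-ε) ε, ContinuousAt f t := fun t ht =>
    hf.continuousOn.continuousAt (isOpen_Ioo.mem_nhds ht)
  have hmetric : ∀ t ∈ Ioo (-ε) ε, ∀ i j, IsEdge K i j →
      ContinuousAt (fun s => C.metric (f s) i j) t := fun t ht i j e =>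
    ContinuousAt.comp (f := f) (g := fun h => C.metric h i j)
      (C.contDiffAt_metric (hfU t ht) e).continuousAt (hcont t ht)
  -- This set is open by the local result and relatively closed by continuity, and the interval is
  -- connected.
  let u : Set ℝ := {t | t ∈ Ioo (-ε) ε ∧ ∃ c, IsScaling K c d (C.metric (f t))}
  have hu_open : IsOpen u := by
    rw [isOpen_iff_mem_nhds]
    rintro t ⟨ht, c, hc⟩
    obtain ⟨hflat', hker⟩ := isRicciFlat_and_kernel hT (C.metric_mem _ (hfU t ht)).1 hflat h hc
    filter_upwards [(hcont t ht).eventually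
      (C.eventually_isScaling_of_scalarCurvature_eq_zero (hfU t ht) hflat' hker),
      isOpen_Ioo.mem_nhds ht] with s h1 h2
    obtain ⟨c', hc'⟩ := h1 fun i => by
      rw [hcurv s h2, scalarCurvature_eq_zero hd.1 hflat]
    exact ⟨h2, c' * c, mul_pos hc'.1 hc.1, fun i j e => by
      rw [hc'.2 i j e, hc.2 i j e, mul_assoc]⟩
  have hu_closed : closure u ∩ Ioo (-ε) ε ⊆ u := by
    rintro t ⟨htu, ht⟩
    have p0 := hd.1.len_pos hab
    have pt := (C.metric_mem _ (hfU t ht)).1.len_pos hab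
    -- The factor is read off from one fixed edge. It is continuous in `t`, and nondegeneracy keeps
    -- it positive in the limit.
    refine ⟨ht, len (C.metric (f t)) a b / len d a b, by positivity, fun i j e => ?_⟩
    have hlenc : ContinuousAt (fun s => len (C.metric (f s)) a b / len d a b * d i j) t :=
      (((hmetric t ht a b hab).add (hmetric t ht b a hab.symm)).div_const _).mul_const _
    have := mem_closure_iff_frequently.1 htu
    refine tendsto_nhds_unique_of_frequently_eq (hmetric t ht i j e) hlenc (this.mono ?_)
    rintro s ⟨-, c, hc⟩
    rw [hc.len hab, hc.2 i j e, mul_div_assoc, div_self p0.ne', mul_one]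
  have h0 : (0 : ℝ) ∈ Ioo (-ε) ε := ⟨by linarith, hε⟩
  have hsub := isPreconnected_Ioo.subset_of_closure_inter_subset hu_open
    ⟨0, h0, h0, 1, one_pos, fun i j e => by rw [hf0 i j e, one_mul]⟩ hu_closed
  intro t ht
  obtain ⟨-, c, hc⟩ := hsub ht
  exact ⟨c, hc⟩

end Rigidity

end PiecewiseFlat

end

theorem mainTheorem9 {M : Type*} [TopologicalSpace M] [T2Space M] [CompactSpace M]
    [ConnectedSpace M] [ChartedSpace (EuclideanSpace ℝ (Fin 3)) M]
    {V : Type*} [Fintype V] [DecidableEq V] (T : AbstractSimplicialComplex V)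
    (hT : PiecewiseFlat.IsTriangulation T M)
    (d : V → V → ℝ) (hd : d ∈ PiecewiseFlat.met T)
    (hflat : PiecewiseFlat.IsRicciFlat T d)
    (h : (∀ i j, PiecewiseFlat.IsEdge T i j → 0 < PiecewiseFlat.dualLength T d i j) ∨
      PiecewiseFlat.IsSpherePacking T d) :
    PiecewiseFlat.IsRigid T d :=
  PiecewiseFlat.isRigid_of_isRicciFlat hT hd hflat h
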